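/- **Setting.** Let $\Xi$ be a probability law on a space of data points $\xi$ (state–action–state transitions; no further structure is used), and let $f(\theta,\omega;\xi)$ be a real loss, $\theta,\omega\in\mathbb{R}^d$, $d\ge 1$. Put $F(\theta,\omega)=\mathbb{E}_{\xi\sim\Xi}f(\theta,\omega;\xi)$. (In TD learning, $f$ is the primal–dual form of the projected Bellman error.) Let $\Theta,\Omega\subseteq\mathbb{R}^d$, $J(\theta)=\max_{\omega\in\Omega}F(\theta,\omega)$ and $\omega^*(\theta)=\operatorname{argmax}_{\omega\in\Omega}F(\theta,\omega)$. The data consist of $m$ trajectories of i.i.d. data points of law $\Xi$; $n\ge1$ is the maximum trajectory length. Let $\mathcal{P}_X$ be the Euclidean projection onto $X$. **Assumptions.** (1) $J$ has a minimizer $\theta^*$ on $\Theta$. (2) $\nabla F=(\nabla_\theta F,\nabla_\omega F)$ is $L_F$-Lipschitz on $\Theta\times\Omega$. (3) $\Theta,\Omega$ are closed and convex. (4) For each $\theta\in\Theta$, $F(\theta,\cdot)$ is $\mu$-strongly concave on $\Omega$; $0<\mu\le L_F$. (5) The data points $\xi_0,\xi_1,\dots$ used by the algorithm are i.i.d. with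 law $\Xi$. (6) For some $G>0$, almost surely each of the $m$ trajectories $\tau$ satisfies $\|\sum_{\xi\in\tau}\nabla_\theta f(\theta,\omega;\xi)\|\le nG$ and $\|\sum_{\xi\in\tau}\nabla_\omega f(\theta,\omega;\xi)\|\le nG$ for all $\theta\in\Theta$, $\omega\in\Omega$. (7) Regularity: $f$ is measurable and, at each point of $\Theta\times\Omega$, it is $\Xi$-integrable in $\xi$ and differentiable in $(\theta,\omega)$, and its difference quotients near that point are bounded by a $\Xi$-integrable function of $\xi$. **Algorithm (DPTD).** Start at $\theta_0\in\Theta$, $\omega_0\in\Omega$ with $p_0=\nabla_\theta f(\theta_0,\omega_0;\xi_0)+u_0^p$, $d_0=\nabla_\omega f(\theta_0,\omega_0;\xi_0)+u_0^d$. For $t=0,\dots,T-1$ set $$\tilde\theta_{t+1}=\mathcal{P}_\Theta(\theta_t-\kappa p_t),\quad \tilde\omega_{t+1}=\mathcal{P}_\Omega(\omega_t+\eta d_t),\quad \theta_{t+1}=\theta_t+\nu_t(\tilde\theta_{t+1}-\theta_t),\quad \omega_{t+1}=\omega_t+\nu_t(\tilde\omega_{t+1}-\omega_t),$$ $$p_{t+1}=(1-\alpha\nu_t)p_t+\alpha\nu_t\nabla_\theta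 f(\theta_{t+1},\omega_{t+1};\xi_{t+1})+u^p_{t+1},\qquad d_{t+1}=(1-\beta\nu_t)d_t+\beta\nu_t\nabla_\omega f(\theta_{t+1},\omega_{t+1};\xi_{t+1})+u^d_{t+1},$$ where the noises $u^p_t,u^d_t\sim N(0,\sigma^2 I_d)$ are independent of each other and of the data points. The output is $(\bar\theta,\bar\omega)=(\theta_R,\omega_R)$ with $R$ uniform on $\{0,\dots,T-1\}$ and independent of everything else. The utility metric is $$\mathfrak{M}(\theta_t,\omega_t)=\kappa^{-1}\|\tilde\theta_{t+1}-\theta_t\|+\|\nabla_\theta F(\theta_t,\omega_t)-p_t\|+L_F\|\omega_t-\omega^*(\theta_t)\|.$$ **Parameters.** $\alpha=\beta=3$, $0<\eta\le\mu/(4L_F^2)$, $0<\kappa\le\eta\mu^2/(9L_F^2)$, $\nu_t=\frac{1}{4(t+b)^{1/2}}$ with $b\ge\max\{(2\kappa L_F^2/\mu)^2,3\}$, $\beta'\in(0,1)$, $\varepsilon>0$, $\delta\in(0,1)$, and the noise variance for $(\varepsilon,\delta)$-differential privacy under trajectory $$\sigma^2=\frac{14n^2G^2T\alpha'}{m^2\left(\varepsilon-\frac{\log(1/\delta)}{\alpha'-1}\right)},\qquad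 \alpha'=\frac{\log(1/\delta)}{(1-\beta')\varepsilon}+1.$$ The number of iterations $T$ is $\frac{Cm\varepsilon}{n\sqrt{d\log(1/\delta)}}$, where $C>0$ is a constant, rounded up or down to an integer; this quantity is assumed to be at least $1$. Moreover $\varepsilon\le K\log(1/\delta)$ for a constant $K>0$. **Theorem.** There is a constant $A>0$ that depends only on $L_F,\mu,G,\kappa,\eta,b,\beta',C,K$ and an upper bound $\Delta$ on $J(\theta_0)-J(\theta^*)$ (in particular not on $d,n,m,\varepsilon,\delta$) such that $\mathfrak{M}(\bar\theta,\bar\omega)$ is integrable and $$\mathbb{E}\left[\mathfrak{M}(\bar\theta,\bar\omega)\right]\le A\,\frac{n^{1/4}(d\log(1/\delta))^{1/8}}{(m\varepsilon)^{1/4}}\sqrt{\log(T+b)}.$$ Moreover, the algorithm evaluates exactly $2(T+1)$ stochastic partial gradients, and $2(T+1)\le A\,\frac{m\varepsilon}{n\sqrt{d\log(1/\delta)}}$. -/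

import Mathlib

open MeasureTheory ProbabilityTheory

namespace DPTD

/-- The parameter space `ℝ^d` with the `ℓ²` norm. -/
abbrev Vec (d : ℕ) : Type := EuclideanSpace ℝ (Fin d)

section Objective

variable {d : ℕ} {𝒳 : Type*}

/-- Partial gradient of `g` in the primal variable `θ`. -/
noncomputable def gradPrimal (g : Vec d → Vec d → ℝ) (θ ω : Vec d) : Vec d :=
  gradient (fun θ' => g θ' ω) θ

/-- Partial gradient of `g` in the dual variable `ω`. -/
noncomputable def gradDual (g : Vec d → Vec d → ℝ) (θ ω : Vec d) : Vec d :=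
  gradient (fun ω' => g θ ω') ω

/-- The loss of a single data point, `f(θ, ω; ξ)`, as a function of `(θ, ω)`. -/
def lossAt (f : Vec d → Vec d → 𝒳 → ℝ) (ξ : 𝒳) : Vec d → Vec d → ℝ :=
  fun θ ω => f θ ω ξ

/-- `F(θ, ω) = 𝔼_{ξ ∼ Ξ} f(θ, ω; ξ)`. -/
noncomputable def objective [MeasurableSpace 𝒳] (f : Vec d → Vec d → 𝒳 → ℝ) (Ξ : Measure 𝒳)
    (θ ω : Vec d) : ℝ :=
  ∫ ξ, f θ ω ξ ∂Ξ

/-- `J(θ) = max_{ω ∈ Ω} F(θ, ω)`. -/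
noncomputable def primalValue (F : Vec d → Vec d → ℝ) (Ω : Set (Vec d)) (θ : Vec d) : ℝ :=
  sSup (F θ '' Ω)

/-- `ω⋆(θ)`, a maximizer of `F(θ, ·)` on `Ω` (unique under strong concavity). -/
noncomputable def dualArgmax (F : Vec d → Vec d → ℝ) (Ω : Set (Vec d)) (θ : Vec d) : Vec d :=
  Classical.epsilon fun ω => ω ∈ Ω ∧ IsMaxOn (F θ) Ω ω

/-- Euclidean projection of `x` onto a (nonempty closed convex) set `X`: the nearest point of `X`. -/
noncomputable def proj (X : Set (Vec d)) (x : Vec d) : Vec d :=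
  Classical.epsilon fun y => y ∈ X ∧ ∀ z ∈ X, ‖x - y‖ ≤ ‖x - z‖

/-- The full gradient `∇g = (∇_θ g, ∇_ω g)` is `L`-Lipschitz on `Θ × Ω`, for the `ℓ²` norm of the
concatenated vectors. -/
def GradLipschitz (Θ Ω : Set (Vec d)) (g : Vec d → Vec d → ℝ) (L : ℝ) : Prop :=
  ∀ θ ∈ Θ, ∀ θ' ∈ Θ, ∀ ω ∈ Ω, ∀ ω' ∈ Ω,
    ‖WithLp.toLp 2
        (gradPrimal g θ ω - gradPrimal g θ' ω', gradDual g θ ω - gradDual g θ' ω')‖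
      ≤ L * ‖WithLp.toLp 2 (θ - θ', ω - ω')‖

/-- Almost every trajectory `τ` of `len` i.i.d. data points of law `Ξ` satisfies
`‖∑_{ξ ∈ τ} ∇_θ f(θ, ω; ξ)‖ ≤ nG` and `‖∑_{ξ ∈ τ} ∇_ω f(θ, ω; ξ)‖ ≤ nG` on `Θ × Ω`. -/
def AveragedLipschitz [MeasurableSpace 𝒳] (Θ Ω : Set (Vec d)) (f : Vec d → Vec d → 𝒳 → ℝ)
    (Ξ : Measure 𝒳) (n : ℕ) (G : ℝ) (len : ℕ) : Prop :=
  ∀ᵐ τ ∂(Measure.pi fun _ : Fin len => Ξ), ∀ θ ∈ Θ, ∀ ω ∈ Ω,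
    ‖∑ j, gradPrimal (lossAt f (τ j)) θ ω‖ ≤ n * G ∧
    ‖∑ j, gradDual (lossAt f (τ j)) θ ω‖ ≤ n * G

/-- What is implicit in writing `F = 𝔼 f`, `∇f` and `∇F`: `f` is measurable, integrable in the data
point and differentiable in `(θ, ω)`, and its difference quotients at each point of `Θ × Ω` have an
integrable bound. -/
structure RegularLoss [MeasurableSpace 𝒳] (Θ Ω : Set (Vec d)) (f : Vec d → Vec d → 𝒳 → ℝ)
    (Ξ : Measure 𝒳) : Prop where
  measurable : Measurable fun q : Vec d × Vec d × 𝒳 => f q.1 q.2.1 q.2.2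
  differentiable : ∀ θ ∈ Θ, ∀ ω ∈ Ω, ∀ ξ,
    DifferentiableAt ℝ (fun z : Vec d × Vec d => f z.1 z.2 ξ) (θ, ω)
  integrable : ∀ θ ∈ Θ, ∀ ω ∈ Ω, Integrable (f θ ω) Ξ
  dominated : ∀ θ ∈ Θ, ∀ ω ∈ Ω, ∃ r > 0, ∃ B : 𝒳 → ℝ, Integrable B Ξ ∧
    ∀ᵐ ξ ∂Ξ, ∀ θ' ω', dist (θ', ω') (θ, ω) < r →
      |f θ' ω' ξ - f θ ω ξ| ≤ B ξ * dist (θ', ω') (θ, ω)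

end Objective

section Algorithm

variable {d : ℕ} {𝒳 : Type*}

/-- Input of the algorithm: step sizes, feasible sets and initial point. -/
structure Input (d : ℕ) where
  ν : ℕ → ℝ
  κ : ℝ
  η : ℝ
  α : ℝ
  β : ℝ
  Θ : Set (Vec d)
  Ω : Set (Vec d)
  θ₀ : Vec d
  ω₀ : Vec d

/-- State of the algorithm: the iterates `θ_t`, `ω_t`, the released gradient estimators `p_t`, `d_t`,
and the number of stochastic (partial) gradients evaluated so far. -/
structure State (d : ℕ) where
  θ : Vec d
  ω : Vec d
  p : Vec d
  q : Vec d
  evals : ℕ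

/-- One evaluation of `∇_θ f(θ, ω; ξ)`, counted in `k`. -/
noncomputable def queryPrimal (f : Vec d → Vec d → 𝒳 → ℝ) (θ ω : Vec d) (ξ : 𝒳) (k : ℕ) :
    Vec d × ℕ :=
  (gradPrimal (lossAt f ξ) θ ω, k + 1)

/-- One evaluation of `∇_ω f(θ, ω; ξ)`, counted in `k`. -/
noncomputable def queryDual (f : Vec d → Vec d → 𝒳 → ℝ) (θ ω : Vec d) (ξ : 𝒳) (k : ℕ) :
    Vec d × ℕ :=
  (gradDual (lossAt f ξ) θ ω, k + 1)

/-- `θ̃_{t+1} = 𝒫_Θ(θ_t - κ p_t)`. -/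
noncomputable def tildePrimal (I : Input d) (s : State d) : Vec d :=
  proj I.Θ (s.θ - I.κ • s.p)

/-- `ω̃_{t+1} = 𝒫_Ω(ω_t + η d_t)`. -/
noncomputable def tildeDual (I : Input d) (s : State d) : Vec d :=
  proj I.Ω (s.ω + I.η • s.q)

/-- Initialization, from the data point `ξ₀` and the noises `u₀ᵖ`, `u₀ᵈ`. -/
noncomputable def init (I : Input d) (f : Vec d → Vec d → 𝒳 → ℝ) (ξ : 𝒳) (up ud : Vec d) :
    State d :=
  let gp := queryPrimal f I.θ₀ I.ω₀ ξ 0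
  let gd := queryDual f I.θ₀ I.ω₀ ξ gp.2
  { θ := I.θ₀
    ω := I.ω₀
    p := gp.1 + up
    q := gd.1 + ud
    evals := gd.2 }

/-- Iteration `t`: from the state at time `t` to the state at time `t + 1`, with the data point
`ξ_{t+1}` and the noises `u_{t+1}ᵖ`, `u_{t+1}ᵈ`. -/
noncomputable def step (I : Input d) (f : Vec d → Vec d → 𝒳 → ℝ) (t : ℕ) (s : State d)
    (ξ : 𝒳) (up ud : Vec d) : State d :=
  let θ' := s.θ + I.ν t • (tildePrimal I s - s.θ)
  let ω' := s.ω + I.ν t • (tildeDual I s - s.ω)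
  let gp := queryPrimal f θ' ω' ξ s.evals
  let gd := queryDual f θ' ω' ξ gp.2
  { θ := θ'
    ω := ω'
    p := ((1 - I.α * I.ν t) • s.p + (I.α * I.ν t) • gp.1) + up
    q := ((1 - I.β * I.ν t) • s.q + (I.β * I.ν t) • gd.1) + ud
    evals := gd.2 }

/-- The state after `t` iterations, given the data points and the noises drawn by the algorithm. -/
noncomputable def run (I : Input d) (f : Vec d → Vec d → 𝒳 → ℝ) (ξ : ℕ → 𝒳)
    (up ud : ℕ → Vec d) : ℕ → State d
  | 0 => init I f (ξ 0) (up 0) (ud 0)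
  | t + 1 => step I f t (run I f ξ up ud t) (ξ (t + 1)) (up (t + 1)) (ud (t + 1))

/-- The utility metric
`𝔐 = κ⁻¹ ‖θ̃_{t+1} - θ_t‖ + ‖∇_θ F(θ_t, ω_t) - p_t‖ + L_F ‖ω_t - ω⋆(θ_t)‖` at a state. -/
noncomputable def metric (I : Input d) (F : Vec d → Vec d → ℝ) (LF : ℝ) (s : State d) : ℝ :=
  I.κ⁻¹ * ‖tildePrimal I s - s.θ‖ + ‖gradPrimal F s.θ s.ω - s.p‖
    + LF * ‖s.ω - dualArgmax F I.Ω s.θ‖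

/-- The randomness of the algorithm with `T` iterations: data points `ξ_t` of law `Ξ`, noises
`u_tᵖ, u_tᵈ` of law `N(0, σ² I_d)`, all independent, and an output index `R`, uniform on
`{0, …, T - 1}` and independent of them. -/
structure Randomness [MeasurableSpace 𝒳] {W : Type*} [MeasurableSpace W] (P : Measure W)
    (Ξ : Measure 𝒳) (σsq : ℝ) (T : ℕ) (ξ : ℕ → W → 𝒳) (up ud : ℕ → W → Vec d) (R : W → ℕ) :
    Prop where
  measurable_data : ∀ t, Measurable (ξ t)
  measurable_primal : ∀ t, Measurable (up t)
  measurable_dual : ∀ t, Measurable (ud t)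
  measurable_index : Measurable R
  law : ∀ t, P.map (fun w => (ξ t w, up t w, ud t w)) =
    Ξ.prod ((multivariateGaussian 0 (σsq • (1 : Matrix (Fin d) (Fin d) ℝ))).prod
      (multivariateGaussian 0 (σsq • (1 : Matrix (Fin d) (Fin d) ℝ))))
  indep : iIndepFun (fun t w => (ξ t w, up t w, ud t w)) P
  law_index : P.map R = uniformOn (Set.Iio T)
  indep_index : IndepFun R (fun w t => (ξ t w, up t w, ud t w)) P

end Algorithm

/-- The order `α' = log(1/δ) / ((1 - β')ε) + 1`. -/
noncomputable def renyiOrder (β' ε δ : ℝ) : ℝ :=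
  Real.log (1 / δ) / ((1 - β') * ε) + 1

/-- The noise variance for privacy under trajectory,
`σ² = 14 n² G² T α' / (m² (ε - log(1/δ)/(α' - 1)))`. -/
noncomputable def trajectoryVariance (G β' ε δ : ℝ) (n m T : ℕ) : ℝ :=
  14 * (n : ℝ) ^ 2 * G ^ 2 * T * renyiOrder β' ε δ /
    ((m : ℝ) ^ 2 * (ε - Real.log (1 / δ) / (renyiOrder β' ε δ - 1)))

end DPTD

/-! The proof is a Lyapunov argument. With `J₀` the minimum of `J`, take `V = J(θ) - J₀ + a‖ω -
ω*(θ)‖² + b(‖∇_θ F - p‖² + ‖∇_ω F - q‖²)`, where `q` is the dual estimator, `a = 4κL²/(ημ)` and `b =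
4κL²/μ²`. The primal step decreases `J` up to the tracking error and the error of `p`. The dual step
contracts the tracking error up to the error of `q` and the motion of `θ`. The moving averages
contract both estimation errors up to the displacements. The weights `a`, `b` make each of these
costs smaller than the gain that pays for it (`step_size_bounds`, `SmoothSaddle.potential_step`).

A fresh sample and fresh noise add centred, independent errors to the estimators, so their second
moments add: `𝔼 V_{t+1} + (κ/4) ν_t 𝔼 M_t ≤ 𝔼 V_t + b(18 ν_t² G² + 2dσ²)`, where `M_t` is the sum of
the squares of the three terms of the metric (`lintegral_lyapunov_step`, `lintegral_lyapunov_succ`).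
After telescoping, `∑ ν_t²` is logarithmic, and `dσ²T` is bounded by a constant: `σ²` is
proportional to `T` and `T` is of order `mε/(n√(d log(1/δ)))` (`total_variance_le`). Since `ν_t` is
at least of order `T^(-1/2)`, a uniform index gives `𝔼 𝔐² ≲ log(T+b)/√T`. Jensen's inequality and
the value of `T` give the rate.

Two points are needed to get there. The trajectory bound `nG` gives the almost sure bound `G` for a
single sample, through a trajectory of maximal length (`ae_norm_le_of_ae_norm_sum_le`). Gradients
are controlled only on `Θ × Ω`, so the iterates are handled as points of this subtype. Expectations
are lower integrals of nonnegative quantities, so integrability has to be established for the final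
metric only. -/

namespace DPTD

open Filter Topology
open scoped RealInnerProductSpace ENNReal

/-! ### Euclidean projection onto closed convex sets -/

section Projection

variable {d : ℕ}

lemma proj_spec {X : Set (Vec d)} (hX : IsClosed X) (hne : X.Nonempty) (x : Vec d) :
    proj X x ∈ X ∧ ∀ z ∈ X, ‖x - proj X x‖ ≤ ‖x - z‖ := by
  refine Classical.epsilon_spec (p := fun y => y ∈ X ∧ ∀ z ∈ X, ‖x - y‖ ≤ ‖x - z‖) ?_
  obtain ⟨y, hy, h⟩ := hX.exists_infDist_eq_dist hne x
  refine ⟨y, hy, fun z hz => ?_⟩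
  rw [← dist_eq_norm, ← dist_eq_norm, ← h]
  exact Metric.infDist_le_dist_of_mem hz

lemma proj_mem {X : Set (Vec d)} (hX : IsClosed X) (hne : X.Nonempty) (x : Vec d) :
    proj X x ∈ X :=
  (proj_spec hX hne x).1

lemma inner_sub_proj_le_zero {X : Set (Vec d)} (hX : IsClosed X) (hc : Convex ℝ X)
    (x : Vec d) {z : Vec d} (hz : z ∈ X) :
    ⟪x - proj X x, z - proj X x⟫ ≤ 0 := by
  have hp := proj_spec hX ⟨z, hz⟩ x
  refine (norm_eq_iInf_iff_real_inner_le_zero hc hp.1).1 ?_ z hz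
  have : Nonempty X := ⟨⟨z, hz⟩⟩
  refine le_antisymm (le_ciInf fun w => hp.2 w w.2) ?_
  exact ciInf_le (f := fun w : X => ‖x - w‖) ⟨0, by rintro _ ⟨w, rfl⟩; exact norm_nonneg _⟩
    ⟨_, hp.1⟩

/-- Adding the variational inequalities at the two projected points shows that the projection is
nonexpansive. -/
lemma continuous_proj {X : Set (Vec d)} (hX : IsClosed X) (hc : Convex ℝ X) (hne : X.Nonempty) :
    Continuous (proj X) := by
  refine (LipschitzWith.of_dist_le_mul (K := 1) fun x y => ?_).continuous
  rw [NNReal.coe_one, one_mul, dist_eq_norm, dist_eq_norm]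
  have h1 := inner_sub_proj_le_zero hX hc x (proj_mem hX hne y)
  have h2 := inner_sub_proj_le_zero hX hc y (proj_mem hX hne x)
  have h3 : ‖proj X x - proj X y‖ ^ 2 ≤ ⟪x - y, proj X x - proj X y⟫ := by
    rw [← real_inner_self_eq_norm_sq]
    simp only [inner_sub_left, inner_sub_right] at h1 h2 ⊢
    linarith
  have h4 := real_inner_le_norm (x - y) (proj X x - proj X y)
  by_contra! hlt
  nlinarith [norm_nonneg (x - y), norm_nonneg (proj X x - proj X y)]

end Projection

/-! ### Partial gradients and the total derivative -/

section Gradients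

variable {d : ℕ} {g : Vec d → Vec d → ℝ} {θ ω : Vec d}

lemma hasGradientAt_primal
    (h : DifferentiableAt ℝ (fun z : Vec d × Vec d => g z.1 z.2) (θ, ω)) :
    HasGradientAt (fun θ' => g θ' ω) (gradPrimal g θ ω) θ :=
  DifferentiableAt.hasGradientAt
    (h.comp (f := fun θ' : Vec d => (θ', ω)) θ (by fun_prop))

lemma hasGradientAt_dual
    (h : DifferentiableAt ℝ (fun z : Vec d × Vec d => g z.1 z.2) (θ, ω)) :
    HasGradientAt (fun ω' => g θ ω') (gradDual g θ ω) ω :=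
  DifferentiableAt.hasGradientAt
    (h.comp (f := fun ω' : Vec d => (θ, ω')) ω (by fun_prop))

lemma fderiv_inl_eq_inner_gradPrimal
    (h : DifferentiableAt ℝ (fun z : Vec d × Vec d => g z.1 z.2) (θ, ω)) (a : Vec d) :
    fderiv ℝ (fun z : Vec d × Vec d => g z.1 z.2) (θ, ω) (a, 0) = ⟪gradPrimal g θ ω, a⟫ := by
  have h1 := (h.hasFDerivAt.comp (f := fun θ' : Vec d => (θ', ω)) θ
    ((hasFDerivAt_id θ).prodMk (hasFDerivAt_const ω θ)))
  have h2 := (hasGradientAt_primal h).hasFDerivAt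
  have := congrArg (fun L : Vec d →L[ℝ] ℝ => L a) (h1.unique h2)
  simpa using this

lemma fderiv_inr_eq_inner_gradDual
    (h : DifferentiableAt ℝ (fun z : Vec d × Vec d => g z.1 z.2) (θ, ω)) (a : Vec d) :
    fderiv ℝ (fun z : Vec d × Vec d => g z.1 z.2) (θ, ω) (0, a) = ⟪gradDual g θ ω, a⟫ := by
  have h1 := (h.hasFDerivAt.comp (f := fun ω' : Vec d => (θ, ω')) ω
    ((hasFDerivAt_const θ ω).prodMk (hasFDerivAt_id ω)))
  have h2 := (hasGradientAt_dual h).hasFDerivAt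
  have := congrArg (fun L : Vec d →L[ℝ] ℝ => L a) (h1.unique h2)
  simpa using this

lemma fderiv_eq_inner_add_inner
    (h : DifferentiableAt ℝ (fun z : Vec d × Vec d => g z.1 z.2) (θ, ω)) (a b : Vec d) :
    fderiv ℝ (fun z : Vec d × Vec d => g z.1 z.2) (θ, ω) (a, b)
      = ⟪gradPrimal g θ ω, a⟫ + ⟪gradDual g θ ω, b⟫ := by
  rw [← fderiv_inl_eq_inner_gradPrimal h, ← fderiv_inr_eq_inner_gradDual h, ← map_add]
  simp

lemma hasDerivAt_along_line {a b : Vec d} {s : ℝ}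
    (h : DifferentiableAt ℝ (fun z : Vec d × Vec d => g z.1 z.2) (θ + s • a, ω + s • b)) :
    HasDerivAt (fun s : ℝ => g (θ + s • a) (ω + s • b))
      (⟪gradPrimal g (θ + s • a) (ω + s • b), a⟫ + ⟪gradDual g (θ + s • a) (ω + s • b), b⟫) s := by
  rw [← fderiv_eq_inner_add_inner h]
  have h1 : HasDerivAt (fun s : ℝ => (θ + s • a, ω + s • b)) (a, b) s := by
    refine HasDerivAt.prodMk ?_ ?_
    · simpa using ((hasDerivAt_id s).smul_const a).const_add θ
    · simpa using ((hasDerivAt_id s).smul_const b).const_add ω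
  exact h.hasFDerivAt.comp_hasDerivAt s h1

end Gradients

/-! ### Smooth, strongly concave saddle functions: maximizers and the value function -/

lemma sub_le_of_deriv_sub_le {φ φ' : ℝ → ℝ} {K : ℝ}
    (h : ∀ s ∈ Set.Icc (0 : ℝ) 1, HasDerivAt φ (φ' s) s)
    (hK : ∀ s ∈ Set.Icc (0 : ℝ) 1, φ' s - φ' 0 ≤ K * s) :
    φ 1 - φ 0 ≤ φ' 0 + K / 2 := by
  have hd : ∀ s ∈ Set.Icc (0 : ℝ) 1,
      HasDerivAt (fun s => φ s - s * φ' 0 - K / 2 * s ^ 2) (φ' s - φ' 0 - K * s) s := by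
    intro s hs
    have := ((h s hs).sub ((hasDerivAt_id s).mul_const (φ' 0))).sub
      (((hasDerivAt_id s).pow 2).const_mul (K / 2))
    refine this.congr_deriv ?_
    simp
    ring
  -- Subtracting the linear part and the quadratic majorant leaves a function with nonpositive
  -- derivative on the segment.
  have hanti : AntitoneOn (fun s => φ s - s * φ' 0 - K / 2 * s ^ 2) (Set.Icc 0 1) := by
    refine antitoneOn_of_deriv_nonpos (convex_Icc 0 1)
      (fun s hs => (hd s hs).continuousAt.continuousWithinAt)
      (fun s hs => (hd s (interior_subset hs)).differentiableAt.differentiableWithinAt) ?_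
    intro s hs
    rw [(hd s (interior_subset hs)).deriv]
    linarith [hK s (interior_subset hs)]
  have := hanti (Set.left_mem_Icc.2 zero_le_one) (Set.right_mem_Icc.2 zero_le_one) zero_le_one
  simp at this
  linarith

/-- The standing assumptions on the objective: smooth, with a Lipschitz gradient on `Θ × Ω`, and
strongly concave in the dual variable. -/
structure SmoothSaddle {d : ℕ} (Θ Ω : Set (Vec d)) (F : Vec d → Vec d → ℝ) (L μ : ℝ) : Prop where
  closed_primal : IsClosed Θ
  convex_primal : Convex ℝ Θ
  closed_dual : IsClosed Ω
  convex_dual : Convex ℝ Ω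
  nonempty_dual : Ω.Nonempty
  diff : ∀ θ ∈ Θ, ∀ ω ∈ Ω,
    DifferentiableAt ℝ (fun z : Vec d × Vec d => F z.1 z.2) (θ, ω)
  lip : GradLipschitz Θ Ω F L
  conc : ∀ θ ∈ Θ, StrongConcaveOn Ω μ (F θ)
  pos : 0 < μ
  le : μ ≤ L

namespace SmoothSaddle

variable {d : ℕ} {Θ Ω : Set (Vec d)} {F : Vec d → Vec d → ℝ} {L μ : ℝ}
  {θ θ' ω ω' : Vec d}

lemma pos' (h : SmoothSaddle Θ Ω F L μ) : 0 < L := h.pos.trans_le h.le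

lemma grad_norm_sq_le (h : SmoothSaddle Θ Ω F L μ) (hθ : θ ∈ Θ) (hθ' : θ' ∈ Θ) (hω : ω ∈ Ω)
    (hω' : ω' ∈ Ω) :
    ‖gradPrimal F θ ω - gradPrimal F θ' ω'‖ ^ 2 + ‖gradDual F θ ω - gradDual F θ' ω'‖ ^ 2
      ≤ L ^ 2 * (‖θ - θ'‖ ^ 2 + ‖ω - ω'‖ ^ 2) := by
  have h1 := pow_le_pow_left₀ (norm_nonneg _) (h.lip θ hθ θ' hθ' ω hω ω' hω') 2
  rwa [mul_pow, WithLp.prod_norm_sq_eq_of_L2, WithLp.prod_norm_sq_eq_of_L2] at h1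

lemma gradDual_primal_lip (h : SmoothSaddle Θ Ω F L μ) (hθ : θ ∈ Θ) (hθ' : θ' ∈ Θ) (hω : ω ∈ Ω) :
    ‖gradDual F θ ω - gradDual F θ' ω‖ ≤ L * ‖θ - θ'‖ := by
  have h1 := h.grad_norm_sq_le hθ hθ' hω hω
  refine le_of_sq_le_sq ?_ (mul_nonneg h.pos'.le (norm_nonneg _))
  simp at h1
  nlinarith [sq_nonneg ‖gradPrimal F θ ω - gradPrimal F θ' ω‖]

lemma gradPrimal_dual_lip (h : SmoothSaddle Θ Ω F L μ) (hθ : θ ∈ Θ) (hω : ω ∈ Ω) (hω' : ω' ∈ Ω) :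
    ‖gradPrimal F θ ω - gradPrimal F θ ω'‖ ≤ L * ‖ω - ω'‖ := by
  have h1 := h.grad_norm_sq_le hθ hθ hω hω'
  refine le_of_sq_le_sq ?_ (mul_nonneg h.pos'.le (norm_nonneg _))
  simp at h1
  nlinarith [sq_nonneg ‖gradDual F θ ω - gradDual F θ ω'‖]

lemma inner_grad_sub_le (h : SmoothSaddle Θ Ω F L μ) (hθ : θ ∈ Θ) (hθ' : θ' ∈ Θ) (hω : ω ∈ Ω)
    (hω' : ω' ∈ Ω) (a b : Vec d) :
    |⟪gradPrimal F θ ω - gradPrimal F θ' ω', a⟫ + ⟪gradDual F θ ω - gradDual F θ' ω', b⟫|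
      ≤ L * ‖WithLp.toLp 2 (θ - θ', ω - ω')‖ * ‖WithLp.toLp 2 (a, b)‖ := by
  have h1 := abs_real_inner_le_norm
    (WithLp.toLp 2 (gradPrimal F θ ω - gradPrimal F θ' ω', gradDual F θ ω - gradDual F θ' ω'))
    (WithLp.toLp 2 (a, b))
  rw [WithLp.prod_inner_apply] at h1
  exact h1.trans (mul_le_mul_of_nonneg_right (h.lip θ hθ θ' hθ' ω hω ω' hω') (norm_nonneg _))

/-- The segment between the two points stays in `Θ × Ω`, so the Lipschitz bound applies along it.
Cauchy–Schwarz in the `ℓ²` product keeps the constant at exactly `L/2`. -/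
lemma abs_taylor_le (h : SmoothSaddle Θ Ω F L μ) (hθ : θ ∈ Θ) (hθ' : θ' ∈ Θ) (hω : ω ∈ Ω)
    (hω' : ω' ∈ Ω) :
    |F θ' ω' - F θ ω - (⟪gradPrimal F θ ω, θ' - θ⟫ + ⟪gradDual F θ ω, ω' - ω⟫)|
      ≤ L / 2 * (‖θ' - θ‖ ^ 2 + ‖ω' - ω‖ ^ 2) := by
  set a := θ' - θ with ha
  set b := ω' - ω with hb
  have hmθ : ∀ s ∈ Set.Icc (0 : ℝ) 1, θ + s • a ∈ Θ := fun s hs =>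
    h.convex_primal.add_smul_sub_mem hθ hθ' hs
  have hmω : ∀ s ∈ Set.Icc (0 : ℝ) 1, ω + s • b ∈ Ω := fun s hs =>
    h.convex_dual.add_smul_sub_mem hω hω' hs
  have hd : ∀ s ∈ Set.Icc (0 : ℝ) 1, HasDerivAt (fun s : ℝ => F (θ + s • a) (ω + s • b))
      (⟪gradPrimal F (θ + s • a) (ω + s • b), a⟫ + ⟪gradDual F (θ + s • a) (ω + s • b), b⟫) s :=
    fun s hs => hasDerivAt_along_line (h.diff _ (hmθ s hs) _ (hmω s hs))
  have hnorm : ‖WithLp.toLp 2 (a, b)‖ ^ 2 = ‖a‖ ^ 2 + ‖b‖ ^ 2 := by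
    simp [WithLp.prod_norm_sq_eq_of_L2]
  have hK : ∀ s ∈ Set.Icc (0 : ℝ) 1,
      |(⟪gradPrimal F (θ + s • a) (ω + s • b), a⟫ + ⟪gradDual F (θ + s • a) (ω + s • b), b⟫)
        - (⟪gradPrimal F (θ + (0 : ℝ) • a) (ω + (0 : ℝ) • b), a⟫
          + ⟪gradDual F (θ + (0 : ℝ) • a) (ω + (0 : ℝ) • b), b⟫)|
      ≤ L * (‖a‖ ^ 2 + ‖b‖ ^ 2) * s := by
    intro s hs
    have := h.inner_grad_sub_le (hmθ s hs) hθ (hmω s hs) hω a b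
    have e : WithLp.toLp 2 (θ + s • a - θ, ω + s • b - ω) = s • WithLp.toLp 2 (a, b) := by
      rw [add_sub_cancel_left, add_sub_cancel_left]
      rfl
    rw [e, norm_smul, Real.norm_eq_abs, abs_of_nonneg hs.1] at this
    simp only [zero_smul, add_zero]
    simp only [inner_sub_left] at this
    calc _ ≤ _ := le_of_eq (by congr 1; ring)
      _ ≤ _ := this
      _ = _ := by rw [← hnorm]; ring
  have h1 := sub_le_of_deriv_sub_le hd fun s hs => (le_abs_self _).trans (hK s hs)
  have h2 := sub_le_of_deriv_sub_le (φ := fun s => -F (θ + s • a) (ω + s • b))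
    (K := L * (‖a‖ ^ 2 + ‖b‖ ^ 2))
    (fun s hs => (hd s hs).neg)
    fun s hs => by
      have := (neg_le_abs _).trans (hK s hs)
      linarith
  have e1 : θ + a = θ' := by simp [ha]
  have e2 : ω + b = ω' := by simp [hb]
  simp only [one_smul, zero_smul, add_zero, e1, e2] at h1 h2
  rw [abs_le]
  constructor <;> linarith

/-- Strong concavity bounds the slopes of `F θ` along the segment from below; letting the parameter
tend to `0` from the right turns them into the directional derivative. -/
lemma le_linear_sub (h : SmoothSaddle Θ Ω F L μ) (hθ : θ ∈ Θ) (hω : ω ∈ Ω) (hω' : ω' ∈ Ω) :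
    F θ ω' ≤ F θ ω + ⟪gradDual F θ ω, ω' - ω⟫ - μ / 2 * ‖ω' - ω‖ ^ 2 := by
  have hd : HasDerivAt (fun s : ℝ => F θ (ω + s • (ω' - ω))) ⟪gradDual F θ ω, ω' - ω⟫ 0 := by
    have := hasDerivAt_along_line (g := F) (θ := θ) (ω := ω) (a := 0) (b := ω' - ω) (s := 0)
      (by simpa using h.diff θ hθ ω hω)
    simpa using this
  have ht : Tendsto (fun s : ℝ => s⁻¹ * (F θ (ω + s • (ω' - ω)) - F θ ω)) (𝓝[>] 0)
      (𝓝 ⟪gradDual F θ ω, ω' - ω⟫) := by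
    simpa using hd.tendsto_slope_zero_right
  have hl : Tendsto (fun s : ℝ => F θ ω' - F θ ω + (1 - s) * (μ / 2 * ‖ω' - ω‖ ^ 2)) (𝓝[>] 0)
      (𝓝 (F θ ω' - F θ ω + (1 - 0) * (μ / 2 * ‖ω' - ω‖ ^ 2))) :=
    (Continuous.tendsto (by fun_prop) 0).mono_left nhdsWithin_le_nhds
  have hle := le_of_tendsto_of_tendsto hl ht ?_
  · linarith
  filter_upwards [Ioo_mem_nhdsGT (zero_lt_one (α := ℝ))] with s hs
  have hc := (h.conc θ hθ).2 hω hω' (by linarith [hs.2] : 0 ≤ 1 - s) hs.1.le (by ring)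
  have e : (1 - s) • ω + s • ω' = ω + s • (ω' - ω) := by
    rw [sub_smul, smul_sub, one_smul]; abel
  rw [e, norm_sub_rev] at hc
  simp only [smul_eq_mul] at hc
  rw [inv_mul_eq_div, le_div_iff₀ hs.1]
  nlinarith

lemma exists_isMaxOn (h : SmoothSaddle Θ Ω F L μ) (hθ : θ ∈ Θ) :
    ∃ ω, ω ∈ Ω ∧ IsMaxOn (F θ) Ω ω := by
  obtain ⟨ω₀, hω₀⟩ := h.nonempty_dual
  have hcont : ContinuousOn (F θ) Ω := fun ω hω =>
    ((h.diff θ hθ ω hω).continuousAt.comp (f := fun ω' : Vec d => (θ, ω'))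
      (by fun_prop)).continuousWithinAt
  set g := ‖gradDual F θ ω₀‖
  have hμ := h.pos
  -- At distance `r` from `ω₀` the strongly concave upper bound is `F θ ω₀ + g r - (μ/2) r²`, which
  -- is at most `F θ ω₀` once `r ≥ 2g/μ`. Hence a maximizer over this ball is global, although `Ω`
  -- may be unbounded.
  obtain ⟨ω, hω, hmax⟩ := ((isCompact_closedBall ω₀ (2 * g / μ)).inter_right
    h.closed_dual).exists_isMaxOn
    ⟨ω₀, Metric.mem_closedBall_self (by positivity), hω₀⟩
    (hcont.mono Set.inter_subset_right)
  refine ⟨ω, hω.2, fun ω' hω' => ?_⟩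
  by_cases hb : ω' ∈ Metric.closedBall ω₀ (2 * g / μ)
  · exact hmax ⟨hb, hω'⟩
  · have h1 : F θ ω₀ ≤ F θ ω := hmax ⟨Metric.mem_closedBall_self (by positivity), hω₀⟩
    have h2 := h.le_linear_sub hθ hω₀ hω'
    have h3 := real_inner_le_norm (gradDual F θ ω₀) (ω' - ω₀)
    rw [Metric.mem_closedBall, dist_eq_norm, not_le, div_lt_iff₀ hμ] at hb
    have h4 : 0 ≤ ‖ω' - ω₀‖ := norm_nonneg _
    change F θ ω' ≤ F θ ω
    nlinarith

lemma argmax_spec (h : SmoothSaddle Θ Ω F L μ) (hθ : θ ∈ Θ) :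
    dualArgmax F Ω θ ∈ Ω ∧ IsMaxOn (F θ) Ω (dualArgmax F Ω θ) :=
  Classical.epsilon_spec (p := fun ω => ω ∈ Ω ∧ IsMaxOn (F θ) Ω ω) (h.exists_isMaxOn hθ)

lemma argmax_mem (h : SmoothSaddle Θ Ω F L μ) (hθ : θ ∈ Θ) : dualArgmax F Ω θ ∈ Ω :=
  (h.argmax_spec hθ).1

lemma primalValue_eq (h : SmoothSaddle Θ Ω F L μ) (hθ : θ ∈ Θ) :
    primalValue F Ω θ = F θ (dualArgmax F Ω θ) := by
  refine IsGreatest.csSup_eq ⟨⟨_, h.argmax_mem hθ, rfl⟩, ?_⟩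
  rintro _ ⟨ω, hω, rfl⟩
  exact (h.argmax_spec hθ).2 hω

lemma inner_argmax_le_zero (h : SmoothSaddle Θ Ω F L μ) (hθ : θ ∈ Θ) (hω : ω ∈ Ω) :
    ⟪gradDual F θ (dualArgmax F Ω θ), ω - dualArgmax F Ω θ⟫ ≤ 0 := by
  set y := dualArgmax F Ω θ
  have hy : y ∈ Ω := h.argmax_mem hθ
  have hd : HasDerivAt (fun s : ℝ => F θ (y + s • (ω - y))) ⟪gradDual F θ y, ω - y⟫ 0 := by
    have := hasDerivAt_along_line (g := F) (θ := θ) (ω := y) (a := 0) (b := ω - y) (s := 0)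
      (by simpa using h.diff θ hθ y hy)
    simpa using this
  have ht := hd.tendsto_slope_zero_right
  refine le_of_tendsto ht ?_
  filter_upwards [Ioo_mem_nhdsGT (zero_lt_one (α := ℝ))] with s hs
  have hle : F θ (y + s • (ω - y)) ≤ F θ y :=
    (h.argmax_spec hθ).2 (h.convex_dual.add_smul_sub_mem hy hω ⟨hs.1.le, hs.2.le⟩)
  simp only [zero_smul, add_zero, zero_add, smul_eq_mul]
  exact mul_nonpos_of_nonneg_of_nonpos (inv_nonneg.2 hs.1.le) (by linarith)

lemma le_argmax_sub (h : SmoothSaddle Θ Ω F L μ) (hθ : θ ∈ Θ) (hω : ω ∈ Ω) :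
    F θ ω ≤ F θ (dualArgmax F Ω θ) - μ / 2 * ‖ω - dualArgmax F Ω θ‖ ^ 2 := by
  have h1 := h.le_linear_sub hθ (h.argmax_mem hθ) hω
  have h2 := h.inner_argmax_le_zero hθ hω
  linarith

/-- Adding the strong concavity bounds for `F θ` between the two maximizers to their optimality
conditions gives `μ‖a - b‖² ≤ ⟪∇_ω F(θ,b) - ∇_ω F(θ',b), a - b⟫`, and the gradient difference is at
most `L‖θ - θ'‖`. -/
lemma argmax_lip (h : SmoothSaddle Θ Ω F L μ) (hθ : θ ∈ Θ) (hθ' : θ' ∈ Θ) :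
    ‖dualArgmax F Ω θ - dualArgmax F Ω θ'‖ ≤ L / μ * ‖θ - θ'‖ := by
  set a := dualArgmax F Ω θ
  set b := dualArgmax F Ω θ'
  have ha : a ∈ Ω := h.argmax_mem hθ
  have hb : b ∈ Ω := h.argmax_mem hθ'
  have h1 := h.inner_argmax_le_zero hθ hb
  have h2 := h.inner_argmax_le_zero hθ' ha
  have h3 := h.le_linear_sub hθ ha hb
  have h4 := h.le_linear_sub hθ hb ha
  have h5 := (real_inner_le_norm (gradDual F θ b - gradDual F θ' b) (a - b)).trans
    (mul_le_mul_of_nonneg_right (h.gradDual_primal_lip hθ hθ' hb) (norm_nonneg _))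
  rw [norm_sub_rev b a] at h3
  change ⟪gradDual F θ a, b - a⟫ ≤ 0 at h1
  change ⟪gradDual F θ' b, a - b⟫ ≤ 0 at h2
  rw [inner_sub_left] at h5
  have h6 : μ * ‖a - b‖ ^ 2 ≤ L * ‖θ - θ'‖ * ‖a - b‖ := by linarith
  have hμ := h.pos
  rw [div_mul_eq_mul_div, le_div_iff₀ hμ]
  rcases (norm_nonneg (a - b)).eq_or_lt with h0 | h0
  · rw [← h0, zero_mul]
    exact mul_nonneg h.pos'.le (norm_nonneg _)
  · refine le_of_mul_le_mul_right ?_ h0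
    linarith

/-- Used at the starting point, where it bounds the tracking error by the gradient alone and keeps
the size of `Ω` out of the constants. -/
lemma dist_argmax_le (h : SmoothSaddle Θ Ω F L μ) (hθ : θ ∈ Θ) (hω : ω ∈ Ω) :
    ‖ω - dualArgmax F Ω θ‖ ≤ ‖gradDual F θ ω‖ / μ := by
  set a := dualArgmax F Ω θ
  have ha : a ∈ Ω := h.argmax_mem hθ
  have h1 := h.le_linear_sub hθ hω ha
  have h2 := h.le_argmax_sub hθ hω
  have h5 := real_inner_le_norm (gradDual F θ ω) (a - ω)
  rw [norm_sub_rev a ω] at h1 h5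
  change F θ ω ≤ F θ a - μ / 2 * ‖ω - a‖ ^ 2 at h2
  have h6 : μ * ‖ω - a‖ ^ 2 ≤ ‖gradDual F θ ω‖ * ‖ω - a‖ := by linarith
  rw [le_div_iff₀ h.pos]
  rcases (norm_nonneg (ω - a)).eq_or_lt with h0 | h0
  · rw [← h0, zero_mul]
    positivity
  · refine le_of_mul_le_mul_right ?_ h0
    linarith

/-- One-sided descent lemma for the value function. -/
lemma primalValue_le (h : SmoothSaddle Θ Ω F L μ) (hθ : θ ∈ Θ) (hθ' : θ' ∈ Θ) :
    primalValue F Ω θ' ≤ primalValue F Ω θ + ⟪gradPrimal F θ (dualArgmax F Ω θ), θ' - θ⟫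
      + L / 2 * (1 + L ^ 2 / μ ^ 2) * ‖θ' - θ‖ ^ 2 := by
  rw [h.primalValue_eq hθ, h.primalValue_eq hθ']
  -- Expanding `F` around `(θ, ω*(θ))` avoids differentiating `J`: the first-order dual term is
  -- nonpositive by optimality of `ω*(θ)`, and the Lipschitz maximizer controls the quadratic dual
  -- remainder.
  have h1 := (abs_le.1 (h.abs_taylor_le hθ hθ' (h.argmax_mem hθ) (h.argmax_mem hθ'))).2
  have h2 := h.inner_argmax_le_zero hθ (h.argmax_mem hθ')
  have h3 := pow_le_pow_left₀ (norm_nonneg _) (h.argmax_lip hθ' hθ) 2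
  rw [mul_pow, div_pow] at h3
  nlinarith [h.pos']

end SmoothSaddle

/-! ### Weighted norm inequalities and the Lyapunov decrease of one iteration -/

lemma norm_add_sq_le_young {E : Type*} [SeminormedAddCommGroup E] (a b : E) {c : ℝ} (hc : 0 < c) :
    ‖a + b‖ ^ 2 ≤ (1 + c) * ‖a‖ ^ 2 + (1 + 1 / c) * ‖b‖ ^ 2 := by
  have h1 := pow_le_pow_left₀ (norm_nonneg _) (norm_add_le a b) 2
  have h2 : 2 * ‖a‖ * ‖b‖ ≤ c * ‖a‖ ^ 2 + 1 / c * ‖b‖ ^ 2 := by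
    have h3 : 0 ≤ 1 / c * (c * ‖a‖ - ‖b‖) ^ 2 := by positivity
    have h4 : 1 / c * (c * ‖a‖ - ‖b‖) ^ 2
        = c * ‖a‖ ^ 2 + 1 / c * ‖b‖ ^ 2 - 2 * ‖a‖ * ‖b‖ := by
      field_simp
      ring
    linarith
  nlinarith

/-- A moving average with damping `1 - c` keeps a contraction of order `c` and pays `1/c` for drift:
Young's inequality with weight `c` works because `(1-c)²(1+c) ≤ 1 - c`. -/
lemma sq_mul_norm_add_sq_le {E : Type*} [SeminormedAddCommGroup E] (a b : E) {c : ℝ} (hc : 0 < c)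
    (hc1 : c ≤ 1) :
    (1 - c) ^ 2 * ‖a + b‖ ^ 2 ≤ (1 - c) * ‖a‖ ^ 2 + 1 / c * ‖b‖ ^ 2 := by
  have h1 := mul_le_mul_of_nonneg_left (norm_add_sq_le_young a b hc) (sq_nonneg (1 - c))
  have h2 : (1 - c) ^ 2 * (1 + c) ≤ 1 - c := by nlinarith [sq_nonneg c]
  have h3 : (1 - c) ^ 2 * (1 + 1 / c) ≤ 1 / c := by
    have : (1 - c) ^ 2 * (1 + 1 / c) = ((1 - c) ^ 2 * (1 + c)) * (1 / c) := by
      field_simp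
      ring
    rw [this]
    exact mul_le_of_le_one_left (by positivity) (by linarith)
  nlinarith [mul_le_mul_of_nonneg_right h2 (sq_nonneg ‖a‖),
    mul_le_mul_of_nonneg_right h3 (sq_nonneg ‖b‖)]

lemma norm_add_smul_sub_sq_le {E : Type*} [NormedAddCommGroup E] [InnerProductSpace ℝ E]
    (x y z : E) {s : ℝ} (hs : 0 ≤ s) (hs1 : s ≤ 1) :
    ‖x + s • (y - x) - z‖ ^ 2 ≤ (1 - s) * ‖x - z‖ ^ 2 + s * ‖y - z‖ ^ 2 := by
  have e : x + s • (y - x) - z = (x - z) + s • ((y - z) - (x - z)) := by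
    rw [sub_sub_sub_cancel_right]; abel
  rw [e]
  generalize x - z = a
  generalize y - z = b
  rw [norm_add_sq_real, norm_smul, inner_smul_right, inner_sub_right, mul_pow, norm_sub_sq_real,
    real_inner_self_eq_norm_sq, Real.norm_eq_abs, sq_abs, real_inner_comm]
  have h := norm_sub_sq_real a b
  rw [real_inner_comm] at h
  nlinarith [mul_nonneg (mul_nonneg hs (sub_nonneg.2 hs1)) (sq_nonneg ‖a - b‖)]

/-- These are the absorption conditions of the Lyapunov argument, in this order: the error of `p`;
the error of `q`; the tracking error, whose gain `2κL²` pays the primal cost `κL²` and leaves as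
much over; the dual displacement, paid by the `3/4` from projection; the primal displacement, which
may use only half of the available `1/(2κ)`. -/
lemma step_size_bounds {κ η μ L s a b : ℝ} (hμ : 0 < μ) (hμL : μ ≤ L) (hκ : 0 < κ) (hη : 0 < η)
    (hη' : η * (4 * L ^ 2) ≤ μ) (hκ' : κ * (9 * L ^ 2) ≤ η * μ ^ 2) (hs : 0 < s) (hs1 : s ≤ 1 / 6)
    (ha : a = 4 * κ * L ^ 2 / (η * μ)) (hb : b = 4 * κ * L ^ 2 / μ ^ 2) :
    κ ≤ b ∧ a * (2 * (η / μ)) ≤ 3 * b ∧ a * (η * μ / 2) = 2 * (κ * L ^ 2) ∧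
      b * (L ^ 2 / 3) ≤ 3 / 4 * a ∧
      L / 2 * (1 + L ^ 2 / μ ^ 2) * s + a * (3 * L ^ 2 / (η * μ ^ 3)) + b * (L ^ 2 / 3)
        ≤ 1 / (4 * κ) := by
  have hL : 0 < L := hμ.trans_le hμL
  have hηL : η * L ≤ 1 / 4 := by
    refine le_of_mul_le_mul_right ?_ hL
    nlinarith
  have hημ : η * μ ≤ 1 / 4 := (mul_le_mul_of_nonneg_left hμL hη.le).trans hηL
  have hsq : μ ^ 2 ≤ L ^ 2 := by gcongr
  have hb0 : 0 ≤ b := by rw [hb]; positivity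
  refine ⟨?_, ?_, ?_, ?_, ?_⟩
  · rw [hb, le_div_iff₀ (by positivity)]
    nlinarith
  · have : a * (2 * (η / μ)) = 2 * b := by
      rw [ha, hb]; field_simp
    linarith
  · rw [ha]; field_simp; norm_num
  · have e : 3 / 4 * a - b * (L ^ 2 / 3)
        = κ * L ^ 2 / (3 * η * μ ^ 2) * (9 * μ - 4 * L ^ 2 * η) := by
      rw [ha, hb]; field_simp; ring
    have : 0 ≤ κ * L ^ 2 / (3 * η * μ ^ 2) * (9 * μ - 4 * L ^ 2 * η) :=
      mul_nonneg (by positivity) (by linarith)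
    linarith
  -- After factoring out `1/κ`, every term is a multiple of `r`, and the step size condition on `κ`
  -- says `r ≤ 1/9`.
  · set r := κ * L ^ 2 / (η * μ ^ 2) with hr
    have hr0 : 0 < r := by positivity
    have hr1 : r ≤ 1 / 9 := by
      rw [hr, div_le_iff₀ (by positivity)]; linarith
    have t1 : L / 2 * (1 + L ^ 2 / μ ^ 2) * s ≤ 1 / κ * (r * (η * L)) * s := by
      have e : 1 / κ * (r * (η * L)) = L * (L ^ 2 / μ ^ 2) := by
        rw [hr]; field_simp
      rw [e]
      have : 1 ≤ L ^ 2 / μ ^ 2 := (one_le_div (by positivity)).2 hsq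
      refine mul_le_mul_of_nonneg_right ?_ hs.le
      nlinarith
    have t2 : a * (3 * L ^ 2 / (η * μ ^ 3)) = 1 / κ * (12 * r ^ 2) := by
      rw [ha, hr]; field_simp; norm_num
    have t3 : b * (L ^ 2 / 3) = 1 / κ * (4 / 3 * r ^ 2 * (η * μ) ^ 2) := by
      rw [hb, hr]; field_simp
    have t4 : (1 : ℝ) / (4 * κ) = 1 / κ * (1 / 4) := by field_simp
    rw [t2, t3, t4]
    have r2 : r ^ 2 ≤ (1 / 9) ^ 2 := by gcongr
    have r4 : 4 / 3 * r ^ 2 * (η * μ) ^ 2 ≤ 4 / 3 * (1 / 9) ^ 2 * (1 / 4) ^ 2 := by gcongr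
    have r5 : r * (η * L) * s ≤ 1 / 9 * (1 / 4) * (1 / 6) := by gcongr
    have : 1 / κ * (r * (η * L) * s + 12 * r ^ 2 + 4 / 3 * r ^ 2 * (η * μ) ^ 2)
        ≤ 1 / κ * (1 / 4) := by
      refine mul_le_mul_of_nonneg_left ?_ (by positivity)
      linarith
    linarith

/-- Lyapunov function: value function, dual tracking error and gradient estimation error. -/
noncomputable def potential {d : ℕ} (Ω : Set (Vec d)) (F : Vec d → Vec d → ℝ) (a b : ℝ)
    (θ ω p q : Vec d) : ℝ :=
  primalValue F Ω θ + a * ‖ω - dualArgmax F Ω θ‖ ^ 2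
    + b * (‖gradPrimal F θ ω - p‖ ^ 2 + ‖gradDual F θ ω - q‖ ^ 2)

namespace SmoothSaddle

variable {d : ℕ} {Θ Ω : Set (Vec d)} {F : Vec d → Vec d → ℝ} {L μ : ℝ}
  {θ ω p q : Vec d} {κ η s : ℝ}

/-- The projection inequality gives `⟪p, x - θ⟫ ≤ -‖x - θ‖²/κ`. Replacing `p` by the gradient at
`(θ, ω*(θ))` costs the estimation error plus `L` times the tracking error, and Young's inequality
charges this to half of the decrease. -/
lemma primal_step (h : SmoothSaddle Θ Ω F L μ) (hθ : θ ∈ Θ) (hω : ω ∈ Ω) (hκ : 0 < κ)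
    (hs : 0 ≤ s) (hs1 : s ≤ 1) :
    primalValue F Ω (θ + s • (proj Θ (θ - κ • p) - θ)) ≤ primalValue F Ω θ
      - s * (1 / (2 * κ)) * ‖proj Θ (θ - κ • p) - θ‖ ^ 2
      + s * κ * (‖gradPrimal F θ ω - p‖ ^ 2 + L ^ 2 * ‖ω - dualArgmax F Ω θ‖ ^ 2)
      + L / 2 * (1 + L ^ 2 / μ ^ 2) * s ^ 2 * ‖proj Θ (θ - κ • p) - θ‖ ^ 2 := by
  set x := proj Θ (θ - κ • p) with hx
  set y := dualArgmax F Ω θ with hy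
  have hxm : x ∈ Θ := proj_mem h.closed_primal ⟨θ, hθ⟩ _
  have h1 := h.primalValue_le hθ (h.convex_primal.add_smul_sub_mem hθ hxm ⟨hs, hs1⟩)
  rw [add_sub_cancel_left, norm_smul, inner_smul_right, mul_pow, Real.norm_eq_abs, sq_abs] at h1
  have h2 := inner_sub_proj_le_zero h.closed_primal h.convex_primal (θ - κ • p) hθ
  rw [← hx, show θ - κ • p - x = -(x - θ) - κ • p by abel, ← neg_sub x θ, inner_neg_right,
    inner_sub_left, inner_neg_left, inner_smul_left, real_inner_self_eq_norm_sq] at h2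
  simp only [conj_trivial] at h2
  have h3 : ⟪gradPrimal F θ y, x - θ⟫ = ⟪p, x - θ⟫ + ⟪gradPrimal F θ ω - p, x - θ⟫
      - ⟪gradPrimal F θ ω - gradPrimal F θ y, x - θ⟫ := by
    simp only [inner_sub_left]; ring
  have h4 := real_inner_le_norm (gradPrimal F θ ω - p) (x - θ)
  have h5 := (neg_le_abs _).trans
    (abs_real_inner_le_norm (gradPrimal F θ ω - gradPrimal F θ y) (x - θ))
  have h6 := mul_le_mul_of_nonneg_right (h.gradPrimal_dual_lip hθ hω (h.argmax_mem hθ))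
    (norm_nonneg (x - θ))
  rw [← hy] at h6
  have h7 : ⟪p, x - θ⟫ ≤ -(1 / κ) * ‖x - θ‖ ^ 2 := by
    have : κ * (⟪p, x - θ⟫ + 1 / κ * ‖x - θ‖ ^ 2) ≤ 0 := by
      rw [mul_add, ← mul_assoc, mul_one_div_cancel hκ.ne']; linarith
    have := nonpos_of_mul_nonpos_right this hκ
    linarith
  set e := ‖gradPrimal F θ ω - p‖
  set δ := ‖ω - y‖
  set n := ‖x - θ‖
  have h8 : (e + L * δ) * n ≤ 1 / (2 * κ) * n ^ 2 + κ * (e ^ 2 + L ^ 2 * δ ^ 2) := by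
    have a1 : 0 ≤ 1 / (2 * κ) * (n - κ * (e + L * δ)) ^ 2 := by positivity
    have a2 : 1 / (2 * κ) * (n - κ * (e + L * δ)) ^ 2
        = 1 / (2 * κ) * n ^ 2 - (e + L * δ) * n + κ / 2 * (e + L * δ) ^ 2 := by
      field_simp
      ring
    nlinarith [mul_nonneg hκ.le (sq_nonneg (e - L * δ))]
  have h9 : ⟪gradPrimal F θ y, x - θ⟫
      ≤ -(1 / (2 * κ)) * n ^ 2 + κ * (e ^ 2 + L ^ 2 * δ ^ 2) := by
    have : 1 / κ = 1 / (2 * κ) + 1 / (2 * κ) := by field_simp; norm_num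
    rw [this] at h7
    nlinarith
  have h10 := mul_le_mul_of_nonneg_left h9 hs
  nlinarith

lemma dual_contraction (h : SmoothSaddle Θ Ω F L μ) (hθ : θ ∈ Θ) (hω : ω ∈ Ω) (hη : 0 < η)
    (hηL : η * L ≤ 1 / 4) :
    ‖proj Ω (ω + η • q) - dualArgmax F Ω θ‖ ^ 2 ≤ (1 - η * μ) * ‖ω - dualArgmax F Ω θ‖ ^ 2
      - 3 / 4 * ‖proj Ω (ω + η • q) - ω‖ ^ 2 + η / μ * ‖gradDual F θ ω - q‖ ^ 2 := by
  set y := proj Ω (ω + η • q) with hy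
  set z := dualArgmax F Ω θ with hz
  have hym : y ∈ Ω := proj_mem h.closed_dual h.nonempty_dual _
  have hzm : z ∈ Ω := h.argmax_mem hθ
  have hμ := h.pos
  have h1 := inner_sub_proj_le_zero h.closed_dual h.convex_dual (ω + η • q) hzm
  rw [← hy] at h1
  have h2 := h.le_argmax_sub hθ hym
  rw [← hz] at h2
  have h3 := h.le_linear_sub hθ hω hzm
  have h4 := (abs_le.1 (h.abs_taylor_le hθ hθ hω hym)).1
  simp only [sub_self, inner_zero_right, norm_zero, zero_add] at h4
  have h5 := (abs_real_inner_le_norm (gradDual F θ ω - q) (z - y))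
  have h5' := (le_abs_self _).trans h5
  have e1 : ⟪ω + η • q - y, z - y⟫ = ⟪ω - y, z - y⟫ + η * ⟪q, z - y⟫ := by
    rw [show ω + η • q - y = (ω - y) + η • q by abel, inner_add_left, inner_smul_left]
    simp
  have e2 : ⟪q, z - y⟫ = ⟪gradDual F θ ω, z - ω⟫ - ⟪gradDual F θ ω, y - ω⟫
      - ⟪gradDual F θ ω - q, z - y⟫ := by
    simp only [inner_sub_left, inner_sub_right]; ring
  have e3 : ‖ω - z‖ ^ 2 = ‖ω - y‖ ^ 2 - 2 * ⟪ω - y, z - y⟫ + ‖z - y‖ ^ 2 := by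
    rw [← norm_sub_sq_real, sub_sub_sub_cancel_right]
  rw [norm_sub_rev z ω] at h3
  rw [norm_sub_rev y z] at h2 ⊢
  rw [norm_sub_rev ω y] at e3
  set r := ‖z - y‖
  set e := ‖gradDual F θ ω - q‖
  set δ := ‖ω - z‖
  set n := ‖y - ω‖
  rw [e1] at h1
  -- The term `μ r²` created here is exactly what quadratic growth at the maximizer `z` pays for.
  have h6 : 2 * (e * r) ≤ μ * r ^ 2 + 1 / μ * e ^ 2 := by
    have a1 : 0 ≤ 1 / μ * (μ * r - e) ^ 2 := by positivity
    have a2 : 1 / μ * (μ * r - e) ^ 2 = μ * r ^ 2 + 1 / μ * e ^ 2 - 2 * (e * r) := by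
      field_simp
      ring
    linarith
  have h7 : μ * δ ^ 2 - L * n ^ 2 - 1 / μ * e ^ 2 ≤ 2 * ⟪q, z - y⟫ := by
    rw [e2]
    linarith
  have h8 := mul_le_mul_of_nonneg_left h7 hη.le
  have h9 : η * (1 / μ * e ^ 2) = η / μ * e ^ 2 := by ring
  nlinarith [mul_le_mul_of_nonneg_right hηL (sq_nonneg n)]

lemma dual_step (h : SmoothSaddle Θ Ω F L μ) {θ' : Vec d} (hθ : θ ∈ Θ) (hω : ω ∈ Ω)
    (hθ' : θ' ∈ Θ) (hη : 0 < η) (hηL : η * L ≤ 1 / 4) (hs : 0 < s) (hs1 : s ≤ 1) :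
    ‖ω + s • (proj Ω (ω + η • q) - ω) - dualArgmax F Ω θ'‖ ^ 2
      ≤ (1 - s * (η * μ) / 2) * ‖ω - dualArgmax F Ω θ‖ ^ 2
        - 3 / 4 * s * ‖proj Ω (ω + η • q) - ω‖ ^ 2
        + 2 * s * (η / μ) * ‖gradDual F θ ω - q‖ ^ 2
        + 3 * L ^ 2 / (s * η * μ ^ 3) * ‖θ' - θ‖ ^ 2 := by
  have hμ := h.pos
  have h1 := h.dual_contraction (q := q) hθ hω hη hηL
  have h2 := norm_add_smul_sub_sq_le ω (proj Ω (ω + η • q)) (dualArgmax F Ω θ) hs.le hs1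
  -- Half of the contraction rate `sημ` is spent on the motion of the maximizer from `θ` to `θ'`.
  have hc : 0 < s * (η * μ) / 2 := by positivity
  have h3 := norm_add_sq_le_young
    (ω + s • (proj Ω (ω + η • q) - ω) - dualArgmax F Ω θ)
    (dualArgmax F Ω θ - dualArgmax F Ω θ') hc
  rw [sub_add_sub_cancel] at h3
  have h4 := pow_le_pow_left₀ (norm_nonneg _) (h.argmax_lip hθ hθ') 2
  rw [mul_pow, div_pow, norm_sub_rev θ] at h4
  have hημ : η * μ ≤ 1 / 4 := (mul_le_mul_of_nonneg_left h.le hη.le).trans hηL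
  set c := s * (η * μ) / 2 with hcdef
  have hc1 : c ≤ 1 / 8 := by
    have : s * (η * μ) ≤ 1 * (1 / 4) := by gcongr
    linarith
  set D := ‖ω - dualArgmax F Ω θ‖ ^ 2
  set Y := ‖proj Ω (ω + η • q) - ω‖ ^ 2
  set Q := ‖gradDual F θ ω - q‖ ^ 2
  set X := ‖θ' - θ‖ ^ 2
  have hD : 0 ≤ D := sq_nonneg _
  have hY : 0 ≤ Y := sq_nonneg _
  have hQ : 0 ≤ Q := sq_nonneg _
  have hX : 0 ≤ X := sq_nonneg _
  have h5 : ‖ω + s • (proj Ω (ω + η • q) - ω) - dualArgmax F Ω θ‖ ^ 2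
      ≤ (1 - 2 * c) * D - 3 / 4 * s * Y + s * (η / μ) * Q := by
    nlinarith [mul_le_mul_of_nonneg_left h1 hs.le]
  have h6 : (1 + c) * ‖ω + s • (proj Ω (ω + η • q) - ω) - dualArgmax F Ω θ‖ ^ 2
      ≤ (1 - c) * D - 3 / 4 * s * Y + 2 * s * (η / μ) * Q := by
    refine (mul_le_mul_of_nonneg_left h5 (by positivity)).trans ?_
    have a1 : 0 ≤ c ^ 2 * D := by positivity
    have a2 : 0 ≤ c * (s * Y) := by positivity
    have a3 : 0 ≤ (1 - c) * (s * (η / μ) * Q) :=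
      mul_nonneg (by linarith) (by positivity)
    nlinarith
  have h7 : (1 + 1 / c) * ‖dualArgmax F Ω θ - dualArgmax F Ω θ'‖ ^ 2
      ≤ 3 * L ^ 2 / (s * η * μ ^ 3) * X := by
    have b1 : 1 + 1 / c ≤ 3 / (s * η * μ) := by
      rw [hcdef]
      rw [← sub_nonneg]
      have : 3 / (s * η * μ) - (1 + 1 / (s * (η * μ) / 2)) = (1 - s * (η * μ)) / (s * η * μ) := by
        field_simp
        ring
      rw [this]
      exact div_nonneg (by linarith) (by positivity)
    calc _ ≤ 3 / (s * η * μ) * (L ^ 2 / μ ^ 2 * X) := by gcongr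
      _ = _ := by field_simp
  linarith

/-- The new error is measured against the gradient at the new point; Lipschitz continuity of the
joint gradient turns the change of target into displacements of the iterates. -/
lemma estimator_step (h : SmoothSaddle Θ Ω F L μ) {θ' ω' : Vec d} (hθ : θ ∈ Θ) (hω : ω ∈ Ω)
    (hθ' : θ' ∈ Θ) (hω' : ω' ∈ Ω) {c : ℝ} (hc : 0 < c) (hc1 : c ≤ 1) :
    ‖(1 - c) • (gradPrimal F θ' ω' - p)‖ ^ 2 + ‖(1 - c) • (gradDual F θ' ω' - q)‖ ^ 2
      ≤ (1 - c) * (‖gradPrimal F θ ω - p‖ ^ 2 + ‖gradDual F θ ω - q‖ ^ 2)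
        + 1 / c * L ^ 2 * (‖θ' - θ‖ ^ 2 + ‖ω' - ω‖ ^ 2) := by
  have h1 := h.grad_norm_sq_le hθ' hθ hω' hω
  have h2 := sq_mul_norm_add_sq_le (gradPrimal F θ ω - p)
    (gradPrimal F θ' ω' - gradPrimal F θ ω) hc hc1
  have h3 := sq_mul_norm_add_sq_le (gradDual F θ ω - q)
    (gradDual F θ' ω' - gradDual F θ ω) hc hc1
  rw [sub_add_sub_cancel'] at h2 h3
  simp only [norm_smul, mul_pow, Real.norm_eq_abs, sq_abs]
  have h4 := mul_le_mul_of_nonneg_left h1 (by positivity : 0 ≤ 1 / c)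
  nlinarith

/-- Decrease of the Lyapunov function along one iteration, before the stochastic errors. -/
lemma potential_step (h : SmoothSaddle Θ Ω F L μ) (hθ : θ ∈ Θ) (hω : ω ∈ Ω) (hκ : 0 < κ)
    (hη : 0 < η) (hη' : η ≤ μ / (4 * L ^ 2)) (hκ' : κ ≤ η * μ ^ 2 / (9 * L ^ 2))
    (hs : 0 < s) (hs1 : s ≤ 1 / 6) {x y : Vec d} (hx : x = proj Θ (θ - κ • p))
    (hy : y = proj Ω (ω + η • q)) {θ' ω' : Vec d} (hθ' : θ' = θ + s • (x - θ))
    (hω' : ω' = ω + s • (y - ω)) :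
    primalValue F Ω θ' + 4 * κ * L ^ 2 / (η * μ) * ‖ω' - dualArgmax F Ω θ'‖ ^ 2
        + 4 * κ * L ^ 2 / μ ^ 2 * (‖(1 - 3 * s) • (gradPrimal F θ' ω' - p)‖ ^ 2
          + ‖(1 - 3 * s) • (gradDual F θ' ω' - q)‖ ^ 2)
      ≤ potential Ω F (4 * κ * L ^ 2 / (η * μ)) (4 * κ * L ^ 2 / μ ^ 2) θ ω p q
        - κ / 4 * s * ((κ⁻¹ * ‖x - θ‖) ^ 2 + ‖gradPrimal F θ ω - p‖ ^ 2
          + (L * ‖ω - dualArgmax F Ω θ‖) ^ 2) := by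
  have hμ := h.pos
  have hL := h.pos'
  have hμL := h.le
  have hxm : x ∈ Θ := hx ▸ proj_mem h.closed_primal ⟨θ, hθ⟩ _
  have hym : y ∈ Ω := hy ▸ proj_mem h.closed_dual h.nonempty_dual _
  have hθm : θ' ∈ Θ := hθ' ▸ h.convex_primal.add_smul_sub_mem hθ hxm ⟨hs.le, by linarith⟩
  have hωm : ω' ∈ Ω := hω' ▸ h.convex_dual.add_smul_sub_mem hω hym ⟨hs.le, by linarith⟩
  rw [le_div_iff₀ (by positivity)] at hη' hκ'
  have hηL : η * L ≤ 1 / 4 := by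
    refine le_of_mul_le_mul_right ?_ hL
    nlinarith
  have h1 := h.primal_step (p := p) hθ hω hκ hs.le (by linarith : s ≤ 1)
  have h2 := h.dual_step (q := q) hθ hω hθm hη hηL hs (by linarith : s ≤ 1)
  have h3 := h.estimator_step (p := p) (q := q) hθ hω hθm hωm
    (by positivity : 0 < 3 * s) (by linarith : 3 * s ≤ 1)
  rw [← hx, ← hθ'] at h1
  rw [← hy, ← hω'] at h2
  have e1 : ‖θ' - θ‖ ^ 2 = s ^ 2 * ‖x - θ‖ ^ 2 := by
    rw [hθ', add_sub_cancel_left, norm_smul, mul_pow, Real.norm_eq_abs, sq_abs]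
  have e2 : ‖ω' - ω‖ ^ 2 = s ^ 2 * ‖y - ω‖ ^ 2 := by
    rw [hω', add_sub_cancel_left, norm_smul, mul_pow, Real.norm_eq_abs, sq_abs]
  rw [e1] at h2
  rw [e1, e2] at h3
  unfold potential
  set D := ‖ω - dualArgmax F Ω θ‖ ^ 2
  set Y := ‖y - ω‖ ^ 2
  set Q := ‖gradDual F θ ω - q‖ ^ 2
  set R := ‖gradPrimal F θ ω - p‖ ^ 2
  set X := ‖x - θ‖ ^ 2
  have hD : 0 ≤ D := sq_nonneg _
  have hY : 0 ≤ Y := sq_nonneg _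
  have hQ : 0 ≤ Q := sq_nonneg _
  have hR : 0 ≤ R := sq_nonneg _
  have hX : 0 ≤ X := sq_nonneg _
  set a := 4 * κ * L ^ 2 / (η * μ) with ha
  set b := 4 * κ * L ^ 2 / μ ^ 2 with hb
  have ha0 : 0 < a := by positivity
  have hb0 : 0 < b := by positivity
  rw [mul_pow, mul_pow, inv_pow]
  have g1 := mul_le_mul_of_nonneg_left h2 ha0.le
  have g2 := mul_le_mul_of_nonneg_left h3 hb0.le
  -- The costs of order `1/s` multiply squared displacements of order `s²`, so all costs are of
  -- order `s`, like the gains.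
  have f1 : 3 * L ^ 2 / (s * η * μ ^ 3) * (s ^ 2 * X) = s * (3 * L ^ 2 / (η * μ ^ 3)) * X := by
    field_simp
  have f2 : 1 / (3 * s) * L ^ 2 * (s ^ 2 * X + s ^ 2 * Y) = s * (L ^ 2 / 3) * (X + Y) := by
    field_simp
  rw [f1] at g1
  rw [f2] at g2
  obtain ⟨cR, cQ, cD, cY, cX⟩ := step_size_bounds hμ hμL hκ hη hη' hκ' hs hs1 ha hb
  have hκκ : κ / 4 * ((κ ^ 2)⁻¹ * X) = 1 / (4 * κ) * X := by field_simp
  have hκ2 : 1 / (2 * κ) = 1 / (4 * κ) + 1 / (4 * κ) := by field_simp; norm_num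
  have m1 := mul_le_mul_of_nonneg_left cR (mul_nonneg hs.le hR)
  have m2 := mul_le_mul_of_nonneg_left cQ (mul_nonneg hs.le hQ)
  have m3 := mul_le_mul_of_nonneg_left cY (mul_nonneg hs.le hY)
  have m4 := mul_le_mul_of_nonneg_left cX (mul_nonneg hs.le hX)
  have m5 : s * D * (a * (η * μ / 2)) = s * D * (2 * (κ * L ^ 2)) := by rw [cD]
  have m6 : 0 ≤ s * D * (κ * L ^ 2) := by positivity
  have m7 : 0 ≤ s * R * κ := by positivity
  have m8 : s * (κ / 4 * ((κ ^ 2)⁻¹ * X)) = s * (1 / (4 * κ) * X) := by rw [hκκ]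
  rw [hκ2] at h1
  linarith

end SmoothSaddle

/-! ### Stochastic gradients: almost sure bounds, measurability, unbiasedness -/

/-- If the sum of `n` independent copies of `v` is almost surely bounded by `n * G`, then `v` is
almost surely bounded by `G`. -/
lemma ae_norm_le_of_ae_norm_sum_le {𝒳 : Type*} [MeasurableSpace 𝒳] {Ξ : Measure 𝒳}
    [IsProbabilityMeasure Ξ] {d n : ℕ} (hn : 1 ≤ n) {G : ℝ} {v : 𝒳 → Vec d} (hv : Measurable v)
    (h : ∀ᵐ τ ∂(Measure.pi fun _ : Fin n => Ξ), ‖∑ j, v (τ j)‖ ≤ n * G) :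
    ∀ᵐ ξ ∂Ξ, ‖v ξ‖ ≤ G := by
  have hsupp : ∀ᵐ x ∂(Ξ.map v), x ∈ (Ξ.map v).support := Measure.support_mem_ae
  filter_upwards [ae_of_ae_map hv.aemeasurable hsupp] with ξ hξ
  by_contra! hlt
  set x := v ξ
  set r := ‖x‖ - G with hr
  have hr0 : 0 < r := sub_pos.2 hlt
  have hpos : 0 < (Ξ.map v) (Metric.ball x r) :=
    (Measure.mem_support_iff_forall _).1 hξ _ (Metric.ball_mem_nhds x hr0)
  rw [Measure.map_apply hv Metric.isOpen_ball.measurableSet] at hpos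
  -- If a support point `x` of the law of `v` had norm above `G`, all `n` independent copies would
  -- fall within `‖x‖ - G` of `x` with positive probability, and their sum would then have norm
  -- above `nG`.
  have hbox : 0 < (Measure.pi fun _ : Fin n => Ξ)
      (Set.univ.pi fun _ => v ⁻¹' Metric.ball x r) := by
    rw [Measure.pi_pi]
    exact pos_iff_ne_zero.2 (Finset.prod_ne_zero_iff.2 fun _ _ => hpos.ne')
  obtain ⟨τ, hτ, hτ'⟩ := Filter.Eventually.and_frequently h
    (frequently_ae_mem_iff.2 hbox.ne') |>.exists
  have hn0 : (0 : ℝ) < n := by exact_mod_cast hn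
  have h1 : ‖∑ j, (v (τ j) - x)‖ < n * r := by
    refine (norm_sum_le _ _).trans_lt ?_
    have : ∑ _j : Fin n, r = n * r := by simp
    rw [← this]
    refine Finset.sum_lt_sum_of_nonempty ⟨⟨0, hn⟩, Finset.mem_univ _⟩ fun j _ => ?_
    rw [← dist_eq_norm]
    exact hτ' j (Set.mem_univ j)
  have h2 : (n : ℝ) * ‖x‖ ≤ ‖∑ j, v (τ j)‖ + ‖∑ j, (v (τ j) - x)‖ := by
    have e : (n : ℝ) • x = ∑ j, v (τ j) - ∑ j, (v (τ j) - x) := by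
      simp [Finset.sum_sub_distrib, Nat.cast_smul_eq_nsmul]
    calc (n : ℝ) * ‖x‖ = ‖(n : ℝ) • x‖ := by rw [norm_smul, Real.norm_eq_abs, abs_of_pos hn0]
      _ ≤ _ := by rw [e]; exact norm_sub_le _ _
  rw [hr] at h1
  nlinarith

lemma measurable_of_forall_coord {α : Type*} [MeasurableSpace α] {d : ℕ} {g : α → Vec d}
    (h : ∀ i, Measurable fun x => g x i) : Measurable g :=
  (WithLp.measurable_toLp 2 (Fin d → ℝ)).comp (measurable_pi_iff.2 h)

section Loss

variable {d : ℕ} {𝒳 : Type*} [MeasurableSpace 𝒳] {Θ Ω : Set (Vec d)}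
  {f : Vec d → Vec d → 𝒳 → ℝ} {Ξ : Measure 𝒳}

/-- This exhibits gradient coordinates as limits of difference quotients along a sequence. The
quotients may leave `Θ × Ω`, which is harmless because `f` is measurable everywhere. -/
lemma HasGradientAt.tendsto_coord {g : Vec d → ℝ} {g' x : Vec d} (h : HasGradientAt g g' x)
    (i : Fin d) :
    Tendsto (fun n : ℕ => ((n : ℝ) + 1) * (g (x + (1 / ((n : ℝ) + 1)) • EuclideanSpace.single i (1 : ℝ))
      - g x)) atTop (𝓝 (g' i)) := by
  have h1 : HasDerivAt (fun s : ℝ => x + s • EuclideanSpace.single i (1 : ℝ))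
      (EuclideanSpace.single i (1 : ℝ)) 0 := by
    simpa using ((hasDerivAt_id (0 : ℝ)).smul_const (EuclideanSpace.single i (1 : ℝ))).const_add x
  have h2 : HasFDerivAt g (InnerProductSpace.toDual ℝ _ g')
      (x + (0 : ℝ) • EuclideanSpace.single i (1 : ℝ)) := by simpa using h.hasFDerivAt
  have h3 := (h2.comp_hasDerivAt 0 h1).tendsto_slope_zero_right
  have h4 := h3.comp (tendsto_nhdsWithin_iff.2 ⟨tendsto_one_div_add_atTop_nhds_zero_nat (𝕜 := ℝ),
    Eventually.of_forall fun n => Set.mem_Ioi.2 (by positivity)⟩)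
  simpa [Function.comp_def, EuclideanSpace.inner_single_right] using h4

namespace RegularLoss

lemma measurable_gradPrimal (h : RegularLoss Θ Ω f Ξ) :
    Measurable fun x : Θ × Ω × 𝒳 => gradPrimal (lossAt f x.2.2) x.1 x.2.1 := by
  refine measurable_of_forall_coord fun i => ?_
  refine measurable_of_tendsto_metrizable (f := fun (n : ℕ) (x : Θ × Ω × 𝒳) =>
    ((n : ℝ) + 1) * (f (x.1 + (1 / ((n : ℝ) + 1)) • EuclideanSpace.single i (1 : ℝ)) x.2.1 x.2.2
      - f x.1 x.2.1 x.2.2)) (fun n => ?_) (tendsto_pi_nhds.2 fun x => ?_)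
  · have h1 : Measurable fun x : Θ × Ω × 𝒳 =>
        ((x.1 : Vec d) + (1 / ((n : ℝ) + 1)) • EuclideanSpace.single i (1 : ℝ),
          (x.2.1 : Vec d), x.2.2) := by fun_prop
    have h2 : Measurable fun x : Θ × Ω × 𝒳 => ((x.1 : Vec d), (x.2.1 : Vec d), x.2.2) := by
      fun_prop
    exact ((h.measurable.comp h1).sub (h.measurable.comp h2)).const_mul _
  · exact HasGradientAt.tendsto_coord (hasGradientAt_primal (g := lossAt f x.2.2)
      (h.differentiable x.1 x.1.2 x.2.1 x.2.1.2 x.2.2)) i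

lemma measurable_gradDual (h : RegularLoss Θ Ω f Ξ) :
    Measurable fun x : Θ × Ω × 𝒳 => gradDual (lossAt f x.2.2) x.1 x.2.1 := by
  refine measurable_of_forall_coord fun i => ?_
  refine measurable_of_tendsto_metrizable (f := fun (n : ℕ) (x : Θ × Ω × 𝒳) =>
    ((n : ℝ) + 1) * (f x.1 (x.2.1 + (1 / ((n : ℝ) + 1)) • EuclideanSpace.single i (1 : ℝ)) x.2.2
      - f x.1 x.2.1 x.2.2)) (fun n => ?_) (tendsto_pi_nhds.2 fun x => ?_)
  · have h1 : Measurable fun x : Θ × Ω × 𝒳 =>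
        ((x.1 : Vec d), (x.2.1 : Vec d) + (1 / ((n : ℝ) + 1)) • EuclideanSpace.single i (1 : ℝ),
          x.2.2) := by fun_prop
    have h2 : Measurable fun x : Θ × Ω × 𝒳 => ((x.1 : Vec d), (x.2.1 : Vec d), x.2.2) := by
      fun_prop
    exact ((h.measurable.comp h1).sub (h.measurable.comp h2)).const_mul _
  · exact HasGradientAt.tendsto_coord (hasGradientAt_dual (g := lossAt f x.2.2)
      (h.differentiable x.1 x.1.2 x.2.1 x.2.1.2 x.2.2)) i

lemma measurable_gradPrimal_data (h : RegularLoss Θ Ω f Ξ) {θ ω : Vec d} (hθ : θ ∈ Θ)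
    (hω : ω ∈ Ω) : Measurable fun ξ => gradPrimal (lossAt f ξ) θ ω :=
  h.measurable_gradPrimal.comp
    (measurable_const.prodMk (measurable_const.prodMk measurable_id) :
      Measurable fun ξ : 𝒳 => ((⟨θ, hθ⟩ : Θ), (⟨ω, hω⟩ : Ω), ξ))

lemma measurable_gradDual_data (h : RegularLoss Θ Ω f Ξ) {θ ω : Vec d} (hθ : θ ∈ Θ)
    (hω : ω ∈ Ω) : Measurable fun ξ => gradDual (lossAt f ξ) θ ω :=
  h.measurable_gradDual.comp
    (measurable_const.prodMk (measurable_const.prodMk measurable_id) :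
      Measurable fun ξ : 𝒳 => ((⟨θ, hθ⟩ : Θ), (⟨ω, hω⟩ : Ω), ξ))

lemma ae_norm_grad_le [IsProbabilityMeasure Ξ] (h : RegularLoss Θ Ω f Ξ) {n : ℕ} (hn : 1 ≤ n)
    {G : ℝ} (hG : AveragedLipschitz Θ Ω f Ξ n G n) {θ ω : Vec d} (hθ : θ ∈ Θ) (hω : ω ∈ Ω) :
    (∀ᵐ ξ ∂Ξ, ‖gradPrimal (lossAt f ξ) θ ω‖ ≤ G) ∧ ∀ᵐ ξ ∂Ξ, ‖gradDual (lossAt f ξ) θ ω‖ ≤ G :=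
  ⟨ae_norm_le_of_ae_norm_sum_le hn (h.measurable_gradPrimal_data hθ hω)
      (hG.mono fun _ hτ => (hτ θ hθ ω hω).1),
    ae_norm_le_of_ae_norm_sum_le hn (h.measurable_gradDual_data hθ hω)
      (hG.mono fun _ hτ => (hτ θ hθ ω hω).2)⟩

/-- Differentiation under the integral at a single point: domination of the difference quotients
centred there suffices. It yields both smoothness of `F` and unbiasedness of the sampled gradients.
-/
lemma hasFDerivAt_objective (h : RegularLoss Θ Ω f Ξ) {θ ω : Vec d} (hθ : θ ∈ Θ) (hω : ω ∈ Ω) :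
    Integrable (fun ξ => fderiv ℝ (fun z : Vec d × Vec d => f z.1 z.2 ξ) (θ, ω)) Ξ ∧
    HasFDerivAt (fun z : Vec d × Vec d => objective f Ξ z.1 z.2)
      (∫ ξ, fderiv ℝ (fun z : Vec d × Vec d => f z.1 z.2 ξ) (θ, ω) ∂Ξ) (θ, ω) := by
  obtain ⟨r, hr, B, hB, hlip⟩ := h.dominated θ hθ ω hω
  refine hasFDerivAt_integral_of_dominated_loc_of_lip' (𝕜 := ℝ) (F := fun z ξ => f z.1 z.2 ξ)
    (s := Metric.ball (θ, ω) r) (bound := B) (Metric.ball_mem_nhds _ hr) (fun z _ => ?_)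
    (h.integrable θ hθ ω hω) ?_ ?_ hB ?_
  · exact (h.measurable.comp (by fun_prop : Measurable fun ξ : 𝒳 => (z.1, z.2, ξ))
      ).aestronglyMeasurable
  · have e : (fun ξ => fderiv ℝ (fun z : Vec d × Vec d => f z.1 z.2 ξ) (θ, ω)) = fun ξ =>
        (innerSL ℝ (gradPrimal (lossAt f ξ) θ ω)).coprod
          (innerSL ℝ (gradDual (lossAt f ξ) θ ω)) := by
      funext ξ
      refine ContinuousLinearMap.ext fun z => ?_
      simpa [lossAt] using fderiv_eq_inner_add_inner (g := lossAt f ξ)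
        (h.differentiable θ hθ ω hω ξ) z.1 z.2
    rw [e]
    have hc : Continuous fun x : Vec d × Vec d => (innerSL ℝ x.1).coprod (innerSL ℝ x.2) := by
      fun_prop
    exact (hc.measurable.comp ((h.measurable_gradPrimal_data hθ hω).prodMk
      (h.measurable_gradDual_data hθ hω))).aestronglyMeasurable
  · filter_upwards [hlip] with ξ hξ z hz
    rw [Real.norm_eq_abs, ← dist_eq_norm]
    exact hξ z.1 z.2 hz
  · exact Eventually.of_forall fun ξ => (h.differentiable θ hθ ω hω ξ).hasFDerivAt

lemma integrable_gradPrimal (h : RegularLoss Θ Ω f Ξ) [IsProbabilityMeasure Ξ] {θ ω : Vec d}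
    (hθ : θ ∈ Θ) (hω : ω ∈ Ω) {G : ℝ} (hG : ∀ᵐ ξ ∂Ξ, ‖gradPrimal (lossAt f ξ) θ ω‖ ≤ G) :
    Integrable (fun ξ => gradPrimal (lossAt f ξ) θ ω) Ξ :=
  .of_bound (h.measurable_gradPrimal_data hθ hω).aestronglyMeasurable G hG

lemma integrable_gradDual (h : RegularLoss Θ Ω f Ξ) [IsProbabilityMeasure Ξ] {θ ω : Vec d}
    (hθ : θ ∈ Θ) (hω : ω ∈ Ω) {G : ℝ} (hG : ∀ᵐ ξ ∂Ξ, ‖gradDual (lossAt f ξ) θ ω‖ ≤ G) :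
    Integrable (fun ξ => gradDual (lossAt f ξ) θ ω) Ξ :=
  .of_bound (h.measurable_gradDual_data hθ hω).aestronglyMeasurable G hG

lemma gradPrimal_objective (h : RegularLoss Θ Ω f Ξ) {θ ω : Vec d} (hθ : θ ∈ Θ) (hω : ω ∈ Ω)
    (hi : Integrable (fun ξ => gradPrimal (lossAt f ξ) θ ω) Ξ) :
    gradPrimal (objective f Ξ) θ ω = ∫ ξ, gradPrimal (lossAt f ξ) θ ω ∂Ξ := by
  obtain ⟨h1, h2⟩ := h.hasFDerivAt_objective hθ hω
  refine ext_inner_right ℝ fun a => ?_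
  rw [← fderiv_inl_eq_inner_gradPrimal h2.differentiableAt, h2.fderiv,
    ContinuousLinearMap.integral_apply h1, real_inner_comm, ← integral_inner hi]
  refine integral_congr_ae (Eventually.of_forall fun ξ => ?_)
  simp only []
  rw [real_inner_comm]
  exact fderiv_inl_eq_inner_gradPrimal (g := lossAt f ξ) (h.differentiable θ hθ ω hω ξ) a

lemma gradDual_objective (h : RegularLoss Θ Ω f Ξ) {θ ω : Vec d} (hθ : θ ∈ Θ) (hω : ω ∈ Ω)
    (hi : Integrable (fun ξ => gradDual (lossAt f ξ) θ ω) Ξ) :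
    gradDual (objective f Ξ) θ ω = ∫ ξ, gradDual (lossAt f ξ) θ ω ∂Ξ := by
  obtain ⟨h1, h2⟩ := h.hasFDerivAt_objective hθ hω
  refine ext_inner_right ℝ fun a => ?_
  rw [← fderiv_inr_eq_inner_gradDual h2.differentiableAt, h2.fderiv,
    ContinuousLinearMap.integral_apply h1, real_inner_comm, ← integral_inner hi]
  refine integral_congr_ae (Eventually.of_forall fun ξ => ?_)
  simp only []
  rw [real_inner_comm]
  exact fderiv_inr_eq_inner_gradDual (g := lossAt f ξ) (h.differentiable θ hθ ω hω ξ) a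

end RegularLoss

end Loss

/-! ### Second moments of sampling errors and Gaussian noise -/

section Moments

variable {d : ℕ} {Z : Type*} [MeasurableSpace Z] {ρ : Measure Z} [IsProbabilityMeasure ρ]

lemma lintegral_norm_add_sq {X : Z → Vec d} (hX : MemLp X 2 ρ) (h0 : ∫ z, X z ∂ρ = 0) (A : Vec d) :
    ∫⁻ z, ENNReal.ofReal (‖A + X z‖ ^ 2) ∂ρ = ENNReal.ofReal (‖A‖ ^ 2 + ∫ z, ‖X z‖ ^ 2 ∂ρ) := by
  have hi : Integrable X ρ := hX.integrable one_le_two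
  have h2 : Integrable (fun z => ‖X z‖ ^ 2) ρ := hX.integrable_norm_pow two_ne_zero
  have h1 : Integrable (fun z => 2 * ⟪A, X z⟫) ρ := (hi.const_inner A).const_mul 2
  have h12 : Integrable (fun z => ‖A‖ ^ 2 + 2 * ⟪A, X z⟫) ρ := (integrable_const _).add h1
  have e : (fun z => ‖A + X z‖ ^ 2) = fun z => ‖A‖ ^ 2 + 2 * ⟪A, X z⟫ + ‖X z‖ ^ 2 := by
    funext z; rw [norm_add_sq_real]
  rw [← ofReal_integral_eq_lintegral_ofReal]
  · rw [e, integral_add h12 h2, integral_add (integrable_const _) h1,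
      integral_const_mul, integral_inner hi, h0]
    simp
  · rw [e]; exact h12.add h2
  · exact Eventually.of_forall fun z => by positivity

lemma integral_norm_mean_sub_sq_le {g : Z → Vec d} (hg : Measurable g) {G : ℝ}
    (hG : ∀ᵐ z ∂ρ, ‖g z‖ ≤ G) :
    ∫ z, ‖(∫ x, g x ∂ρ) - g z‖ ^ 2 ∂ρ ≤ G ^ 2 := by
  have hm : MemLp g 2 ρ := .of_bound hg.aestronglyMeasurable G hG
  have hi : Integrable g ρ := hm.integrable one_le_two
  set m := ∫ x, g x ∂ρ with hmdef
  have h1 : Integrable (fun z => 2 * ⟪m, g z⟫) ρ := (hi.const_inner m).const_mul 2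
  have h2 : Integrable (fun z => ‖g z‖ ^ 2) ρ := hm.integrable_norm_pow two_ne_zero
  have h12 : Integrable (fun z => ‖m‖ ^ 2 - 2 * ⟪m, g z⟫) ρ := (integrable_const _).sub h1
  have e : (fun z => ‖m - g z‖ ^ 2) = fun z => ‖m‖ ^ 2 - 2 * ⟪m, g z⟫ + ‖g z‖ ^ 2 := by
    funext z; rw [norm_sub_sq_real]
  rw [e, integral_add h12 h2, integral_sub (integrable_const _) h1,
    integral_const_mul, integral_inner hi, ← hmdef, real_inner_self_eq_norm_sq]
  have h3 : ∫ z, ‖g z‖ ^ 2 ∂ρ ≤ ∫ _, G ^ 2 ∂ρ := by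
    refine integral_mono_ae h2 (integrable_const _) ?_
    filter_upwards [hG] with z hz
    exact pow_le_pow_left₀ (norm_nonneg _) hz 2
  simp only [integral_const, probReal_univ, one_smul] at h3 ⊢
  nlinarith [sq_nonneg ‖m‖]

/-- The law `N(0, v I_d)` of the privacy noise. -/
noncomputable abbrev noise (d : ℕ) (v : ℝ) : Measure (Vec d) :=
  multivariateGaussian 0 (v • (1 : Matrix (Fin d) (Fin d) ℝ))

lemma integral_norm_sq_noise {v : ℝ} (hv : 0 ≤ v) : ∫ u, ‖u‖ ^ 2 ∂(noise d v) = d * v := by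
  have hS : (v • (1 : Matrix (Fin d) (Fin d) ℝ)).PosSemidef := Matrix.PosSemidef.one.smul hv
  have hm : MemLp (fun u : Vec d => u) 2 (noise d v) := IsGaussian.memLp_two_id
  have hmi : ∀ i, MemLp (fun u : Vec d => u i) 2 (noise d v) := fun i =>
    (EuclideanSpace.proj (𝕜 := ℝ) i).comp_memLp' hm
  simp_rw [EuclideanSpace.real_norm_sq_eq]
  rw [integral_finsetSum _ fun i _ => (hmi i).integrable_sq]
  have : ∀ i : Fin d, ∫ u : Vec d, (u i) ^ 2 ∂(noise d v) = v := by
    intro i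
    have h0 : ∫ u : Vec d, u i ∂(noise d v) = 0 := by
      have := (EuclideanSpace.proj (𝕜 := ℝ) i).integral_comp_comm (hm.integrable one_le_two)
      rw [integral_id_multivariateGaussian] at this
      simpa using this
    have h1 := variance_eval_multivariateGaussian (μ := 0) hS i
    rw [variance_of_integral_eq_zero (hmi i).aestronglyMeasurable.aemeasurable h0] at h1
    simpa using h1
  simp [this]

/-- Sampling error and noise are centred and independent, so the cross terms vanish: the sampling
variance is at most `G²` and the noise contributes the trace `d * v`. -/
lemma lintegral_noisy_gradient_le {v : ℝ} (hv : 0 ≤ v) {g : Z → Vec d} (hg : Measurable g) {G : ℝ}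
    (hG : ∀ᵐ z ∂ρ, ‖g z‖ ≤ G) {m : Vec d} (hm : m = ∫ x, g x ∂ρ) (A : Vec d) (c : ℝ) :
    ∫⁻ z, ENNReal.ofReal (‖A + c • (m - g z.1) - z.2‖ ^ 2) ∂(ρ.prod (noise d v))
      ≤ ENNReal.ofReal (‖A‖ ^ 2 + c ^ 2 * G ^ 2 + d * v) := by
  have hmeas : Measurable fun z : Z × Vec d =>
      ENNReal.ofReal (‖A + c • (m - g z.1) - z.2‖ ^ 2) := by fun_prop
  rw [lintegral_prod _ hmeas.aemeasurable]
  have hid : MemLp (fun u : Vec d => u) 2 (noise d v) := IsGaussian.memLp_two_id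
  have hinner : ∀ z, ∫⁻ u, ENNReal.ofReal (‖A + c • (m - g z) - u‖ ^ 2) ∂(noise d v)
      = ENNReal.ofReal (‖A + c • (m - g z)‖ ^ 2) + ENNReal.ofReal (d * v) := by
    intro z
    have := lintegral_norm_add_sq (X := fun u : Vec d => -u) hid.neg
      (by rw [integral_neg, integral_id_multivariateGaussian, neg_zero]) (A + c • (m - g z))
    simp only [norm_neg, integral_norm_sq_noise hv, ← sub_eq_add_neg] at this
    rw [this, ENNReal.ofReal_add (by positivity) (by positivity)]
  have hgm : MemLp g 2 ρ := .of_bound hg.aestronglyMeasurable G hG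
  have hX : MemLp (fun z => c • (m - g z)) 2 ρ := ((memLp_const m).sub hgm).const_smul c
  have h0 : ∫ z, c • (m - g z) ∂ρ = 0 := by
    rw [integral_smul, integral_sub (integrable_const _) (hgm.integrable one_le_two), ← hm]
    simp
  simp_rw [hinner]
  rw [lintegral_add_right _ measurable_const, lintegral_norm_add_sq hX h0, lintegral_const,
    measure_univ, mul_one, ← ENNReal.ofReal_add (by positivity) (by positivity)]
  refine ENNReal.ofReal_le_ofReal ?_
  have h1 := integral_norm_mean_sub_sq_le hg hG
  simp only [norm_smul, mul_pow, Real.norm_eq_abs, sq_abs]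
  rw [integral_const_mul, hm]
  nlinarith [sq_nonneg c]

end Moments

/-! ### Expected Lyapunov change for one draw from a fixed state -/

section ExpectedStep

variable {d : ℕ} {𝒳 : Type*} [MeasurableSpace 𝒳]

/-- The Lyapunov function at a state of the algorithm. -/
noncomputable def lyapunov (I : Input d) (F : Vec d → Vec d → ℝ) (L μ J₀ : ℝ) (s : State d) : ℝ :=
  potential I.Ω F (4 * I.κ * L ^ 2 / (I.η * μ)) (4 * I.κ * L ^ 2 / μ ^ 2) s.θ s.ω s.p s.q - J₀

/-- The sum of the squares of the three terms of the utility metric. -/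
noncomputable def metricSq (I : Input d) (F : Vec d → Vec d → ℝ) (L : ℝ) (s : State d) : ℝ :=
  (I.κ⁻¹ * ‖tildePrimal I s - s.θ‖) ^ 2 + ‖gradPrimal F s.θ s.ω - s.p‖ ^ 2
    + (L * ‖s.ω - dualArgmax F I.Ω s.θ‖) ^ 2

lemma metricSq_nonneg (I : Input d) (F : Vec d → Vec d → ℝ) (L : ℝ) (s : State d) :
    0 ≤ metricSq I F L s := by
  unfold metricSq; positivity

lemma metric_sq_le (I : Input d) (F : Vec d → Vec d → ℝ) (L : ℝ) (s : State d) :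
    metric I F L s ^ 2 ≤ 3 * metricSq I F L s := by
  unfold metric metricSq
  generalize I.κ⁻¹ * ‖tildePrimal I s - s.θ‖ = x
  generalize ‖gradPrimal F s.θ s.ω - s.p‖ = y
  generalize L * ‖s.ω - dualArgmax F I.Ω s.θ‖ = z
  nlinarith [sq_nonneg (x - y), sq_nonneg (y - z), sq_nonneg (x - z)]

/-- The law of the randomness of one iteration. -/
noncomputable abbrev stepLaw (d : ℕ) (Ξ : Measure 𝒳) (v : ℝ) : Measure (𝒳 × Vec d × Vec d) :=
  Ξ.prod ((noise d v).prod (noise d v))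

/-- Unbiasedness and boundedness of the stochastic gradients of `f` on `Θ × Ω`. -/
structure BoundedOracle (Θ Ω : Set (Vec d)) (f : Vec d → Vec d → 𝒳 → ℝ) (Ξ : Measure 𝒳) (G : ℝ) :
    Prop where
  measurable_primal : Measurable fun x : Θ × Ω × 𝒳 => gradPrimal (lossAt f x.2.2) x.1 x.2.1
  measurable_dual : Measurable fun x : Θ × Ω × 𝒳 => gradDual (lossAt f x.2.2) x.1 x.2.1
  measurable_primal_data : ∀ θ ∈ Θ, ∀ ω ∈ Ω, Measurable fun ξ => gradPrimal (lossAt f ξ) θ ω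
  measurable_dual_data : ∀ θ ∈ Θ, ∀ ω ∈ Ω, Measurable fun ξ => gradDual (lossAt f ξ) θ ω
  bound_primal : ∀ θ ∈ Θ, ∀ ω ∈ Ω, ∀ᵐ ξ ∂Ξ, ‖gradPrimal (lossAt f ξ) θ ω‖ ≤ G
  bound_dual : ∀ θ ∈ Θ, ∀ ω ∈ Ω, ∀ᵐ ξ ∂Ξ, ‖gradDual (lossAt f ξ) θ ω‖ ≤ G
  mean_primal : ∀ θ ∈ Θ, ∀ ω ∈ Ω,
    gradPrimal (objective f Ξ) θ ω = ∫ ξ, gradPrimal (lossAt f ξ) θ ω ∂Ξ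
  mean_dual : ∀ θ ∈ Θ, ∀ ω ∈ Ω,
    gradDual (objective f Ξ) θ ω = ∫ ξ, gradDual (lossAt f ξ) θ ω ∂Ξ

lemma RegularLoss.boundedOracle {Θ Ω : Set (Vec d)} {f : Vec d → Vec d → 𝒳 → ℝ} {Ξ : Measure 𝒳}
    [IsProbabilityMeasure Ξ] (h : RegularLoss Θ Ω f Ξ) {n : ℕ} (hn : 1 ≤ n) {G : ℝ}
    (hG : AveragedLipschitz Θ Ω f Ξ n G n) : BoundedOracle Θ Ω f Ξ G where
  measurable_primal := h.measurable_gradPrimal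
  measurable_dual := h.measurable_gradDual
  measurable_primal_data _ hθ _ hω := h.measurable_gradPrimal_data hθ hω
  measurable_dual_data _ hθ _ hω := h.measurable_gradDual_data hθ hω
  bound_primal _ hθ _ hω := (h.ae_norm_grad_le hn hG hθ hω).1
  bound_dual _ hθ _ hω := (h.ae_norm_grad_le hn hG hθ hω).2
  mean_primal _ hθ _ hω := h.gradPrimal_objective hθ hω
    (h.integrable_gradPrimal hθ hω (h.ae_norm_grad_le hn hG hθ hω).1)
  mean_dual _ hθ _ hω := h.gradDual_objective hθ hω
    (h.integrable_gradDual hθ hω (h.ae_norm_grad_le hn hG hθ hω).2)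

variable {Θ Ω : Set (Vec d)} {f : Vec d → Vec d → 𝒳 → ℝ} {Ξ : Measure 𝒳} [IsProbabilityMeasure Ξ]
  {G v : ℝ}

lemma BoundedOracle.norm_gradDual_le (h : BoundedOracle Θ Ω f Ξ G) {θ ω : Vec d} (hθ : θ ∈ Θ)
    (hω : ω ∈ Ω) : ‖gradDual (objective f Ξ) θ ω‖ ≤ G := by
  rw [h.mean_dual θ hθ ω hω]
  simpa using norm_integral_le_of_norm_le_const (h.bound_dual θ hθ ω hω)

/-- Second moments of the two gradient estimation errors after a fresh query. -/
lemma BoundedOracle.lintegral_errors_le (h : BoundedOracle Θ Ω f Ξ G) (hv : 0 ≤ v) {θ ω : Vec d}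
    (hθ : θ ∈ Θ) (hω : ω ∈ Ω) {K b : ℝ} (hK : 0 ≤ K) (hb : 0 ≤ b) (A B : Vec d) (c : ℝ) :
    ∫⁻ z, ENNReal.ofReal (K + b *
        (‖A + c • (gradPrimal (objective f Ξ) θ ω - gradPrimal (lossAt f z.1) θ ω) - z.2.1‖ ^ 2
        + ‖B + c • (gradDual (objective f Ξ) θ ω - gradDual (lossAt f z.1) θ ω) - z.2.2‖ ^ 2))
        ∂(stepLaw d Ξ v)
      ≤ ENNReal.ofReal (K + b * (‖A‖ ^ 2 + ‖B‖ ^ 2) + b * (2 * (c ^ 2 * G ^ 2) + 2 * (d * v))) := by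
  have hgp := h.measurable_primal_data θ hθ ω hω
  have hgd := h.measurable_dual_data θ hθ ω hω
  have h1 := lintegral_noisy_gradient_le hv hgp (h.bound_primal θ hθ ω hω)
    (h.mean_primal θ hθ ω hω) A c
  have h2 := lintegral_noisy_gradient_le hv hgd (h.bound_dual θ hθ ω hω)
    (h.mean_dual θ hθ ω hω) B c
  set mp := gradPrimal (objective f Ξ) θ ω
  set md := gradDual (objective f Ξ) θ ω
  have hmeas : ∀ {g : 𝒳 → Vec d}, Measurable g → ∀ A m : Vec d,
      Measurable fun z : 𝒳 × Vec d => ENNReal.ofReal (‖A + c • (m - g z.1) - z.2‖ ^ 2) := by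
    intro g hg A m
    fun_prop
  have m1 := hmeas hgp A mp
  have m2 := hmeas hgd B md
  -- Both errors use the same data point, but the expectation of their sum needs only the law of
  -- each pair (data point, noise).
  have p1 : MeasurePreserving (fun z : 𝒳 × Vec d × Vec d => (z.1, z.2.1)) (stepLaw d Ξ v)
      (Ξ.prod (noise d v)) := (MeasurePreserving.id Ξ).prod measurePreserving_fst
  have p2 : MeasurePreserving (fun z : 𝒳 × Vec d × Vec d => (z.1, z.2.2)) (stepLaw d Ξ v)
      (Ξ.prod (noise d v)) := (MeasurePreserving.id Ξ).prod measurePreserving_snd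
  rw [← p1.lintegral_comp m1] at h1
  rw [← p2.lintegral_comp m2] at h2
  have m1' := m1.comp p1.measurable
  have m2' := m2.comp p2.measurable
  simp only [Function.comp_def] at m1' m2'
  have m12 : Measurable fun z : 𝒳 × Vec d × Vec d =>
      ENNReal.ofReal (‖A + c • (mp - gradPrimal (lossAt f z.1) θ ω) - z.2.1‖ ^ 2)
        + ENNReal.ofReal (‖B + c • (md - gradDual (lossAt f z.1) θ ω) - z.2.2‖ ^ 2) :=
    m1'.add m2'
  have e : ∀ z : 𝒳 × Vec d × Vec d, ENNReal.ofReal (K + b *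
        (‖A + c • (mp - gradPrimal (lossAt f z.1) θ ω) - z.2.1‖ ^ 2
        + ‖B + c • (md - gradDual (lossAt f z.1) θ ω) - z.2.2‖ ^ 2))
      = ENNReal.ofReal K + ENNReal.ofReal b *
        (ENNReal.ofReal (‖A + c • (mp - gradPrimal (lossAt f z.1) θ ω) - z.2.1‖ ^ 2)
        + ENNReal.ofReal (‖B + c • (md - gradDual (lossAt f z.1) θ ω) - z.2.2‖ ^ 2)) := by
    intro z
    rw [ENNReal.ofReal_add hK (by positivity), ENNReal.ofReal_mul hb,
      ENNReal.ofReal_add (by positivity) (by positivity)]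
  simp_rw [e]
  rw [lintegral_add_left measurable_const, lintegral_const_mul _ m12,
    lintegral_add_left m1', lintegral_const, measure_univ, mul_one]
  calc _ ≤ ENNReal.ofReal K + ENNReal.ofReal b *
        (ENNReal.ofReal (‖A‖ ^ 2 + c ^ 2 * G ^ 2 + d * v)
          + ENNReal.ofReal (‖B‖ ^ 2 + c ^ 2 * G ^ 2 + d * v)) := by gcongr
    _ = _ := by
      rw [← ENNReal.ofReal_add (by positivity) (by positivity), ← ENNReal.ofReal_mul hb,
        ← ENNReal.ofReal_add hK (by positivity)]
      congr 1
      ring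

variable {I : Input d} {L μ J₀ : ℝ}

lemma step_mem_primal {F : Vec d → Vec d → ℝ} (h : SmoothSaddle I.Θ I.Ω F L μ) {s : State d} {t : ℕ}
    (hν : 0 ≤ I.ν t) (hν1 : I.ν t ≤ 1) (hθ : s.θ ∈ I.Θ) :
    s.θ + I.ν t • (tildePrimal I s - s.θ) ∈ I.Θ :=
  h.convex_primal.add_smul_sub_mem hθ (proj_mem h.closed_primal ⟨_, hθ⟩ _) ⟨hν, hν1⟩

lemma step_mem_dual {F : Vec d → Vec d → ℝ} (h : SmoothSaddle I.Θ I.Ω F L μ) {s : State d} {t : ℕ}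
    (hν : 0 ≤ I.ν t) (hν1 : I.ν t ≤ 1) (hω : s.ω ∈ I.Ω) :
    s.ω + I.ν t • (tildeDual I s - s.ω) ∈ I.Ω :=
  h.convex_dual.add_smul_sub_mem hω (proj_mem h.closed_dual h.nonempty_dual _) ⟨hν, hν1⟩

/-- The next iterates do not depend on the new draw, so only the two estimation errors are random.
The metric stands on the left because subtraction in `ℝ≥0∞` truncates; subtracting `J₀` makes the
Lyapunov function nonnegative. -/
lemma lintegral_lyapunov_step (h : SmoothSaddle I.Θ I.Ω (objective f Ξ) L μ)
    (ho : BoundedOracle I.Θ I.Ω f Ξ G) (hv : 0 ≤ v) (hα : I.α = 3) (hβ : I.β = 3) (hκ : 0 < I.κ)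
    (hη : 0 < I.η) (hη' : I.η ≤ μ / (4 * L ^ 2)) (hκ' : I.κ ≤ I.η * μ ^ 2 / (9 * L ^ 2))
    (hJ : ∀ θ ∈ I.Θ, J₀ ≤ primalValue (objective f Ξ) I.Ω θ) {t : ℕ} (hν : 0 < I.ν t)
    (hν1 : I.ν t ≤ 1 / 6) {s : State d} (hθ : s.θ ∈ I.Θ) (hω : s.ω ∈ I.Ω) :
    ∫⁻ z, ENNReal.ofReal (lyapunov I (objective f Ξ) L μ J₀ (step I f t s z.1 z.2.1 z.2.2))
        ∂(stepLaw d Ξ v)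
      + ENNReal.ofReal (I.κ / 4 * I.ν t * metricSq I (objective f Ξ) L s)
      ≤ ENNReal.ofReal (lyapunov I (objective f Ξ) L μ J₀ s)
        + ENNReal.ofReal (4 * I.κ * L ^ 2 / μ ^ 2 * (18 * I.ν t ^ 2 * G ^ 2 + 2 * (d * v))) := by
  have hμ := h.pos
  have hL := h.pos'
  set θ' := s.θ + I.ν t • (tildePrimal I s - s.θ) with hθ'
  set ω' := s.ω + I.ν t • (tildeDual I s - s.ω) with hω'
  have hθm : θ' ∈ I.Θ := step_mem_primal h hν.le (by linarith) hθ
  have hωm : ω' ∈ I.Ω := step_mem_dual h hν.le (by linarith) hω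
  set F := objective f Ξ with hF
  set a := 4 * I.κ * L ^ 2 / (I.η * μ) with ha
  set b := 4 * I.κ * L ^ 2 / μ ^ 2 with hb
  have ha0 : 0 ≤ a := by positivity
  have hb0 : 0 ≤ b := by positivity
  set K := primalValue F I.Ω θ' - J₀ + a * ‖ω' - dualArgmax F I.Ω θ'‖ ^ 2 with hKdef
  have hK : 0 ≤ K := add_nonneg (sub_nonneg.2 (hJ θ' hθm)) (by positivity)
  have hdet := h.potential_step (p := s.p) (q := s.q) hθ hω hκ hη hη' hκ' hν hν1
    (x := tildePrimal I s) (y := tildeDual I s) rfl rfl hθ' hω'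
  rw [← ha, ← hb] at hdet
  have hst := ho.lintegral_errors_le hv hθm hωm hK hb0
    ((1 - 3 * I.ν t) • (gradPrimal F θ' ω' - s.p)) ((1 - 3 * I.ν t) • (gradDual F θ' ω' - s.q))
    (3 * I.ν t)
  have e : ∀ z : 𝒳 × Vec d × Vec d, lyapunov I F L μ J₀ (step I f t s z.1 z.2.1 z.2.2)
      = K + b * (‖(1 - 3 * I.ν t) • (gradPrimal F θ' ω' - s.p)
          + (3 * I.ν t) • (gradPrimal F θ' ω' - gradPrimal (lossAt f z.1) θ' ω') - z.2.1‖ ^ 2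
        + ‖(1 - 3 * I.ν t) • (gradDual F θ' ω' - s.q)
          + (3 * I.ν t) • (gradDual F θ' ω' - gradDual (lossAt f z.1) θ' ω') - z.2.2‖ ^ 2) := by
    intro z
    simp only [lyapunov, potential, step, queryPrimal, queryDual, hα, hβ]
    rw [← hθ', ← hω', ← ha, ← hb, hKdef]
    -- The new error splits into the damped old error at the new point, the centred sampling error
    -- and the noise.
    have e1 : ∀ m p g u : Vec d, m - ((1 - 3 * I.ν t) • p + (3 * I.ν t) • g + u)
        = (1 - 3 * I.ν t) • (m - p) + (3 * I.ν t) • (m - g) - u := by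
      intro m p g u
      module
    rw [e1, e1]
    ring
  simp_rw [e]
  have hM : 0 ≤ I.κ / 4 * I.ν t * metricSq I F L s :=
    mul_nonneg (by positivity) (metricSq_nonneg _ _ _ _)
  have hN : 0 ≤ b * (18 * I.ν t ^ 2 * G ^ 2 + 2 * (d * v)) := by positivity
  refine (add_le_add_left hst _).trans ?_
  rw [← ENNReal.ofReal_add (by positivity) hM]
  refine le_trans (ENNReal.ofReal_le_ofReal ?_) ENNReal.ofReal_add_le
  unfold lyapunov metricSq
  rw [← ha, ← hb]
  nlinarith

/-- The expected initial value of the Lyapunov function. -/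
lemma lintegral_lyapunov_init_le (h : SmoothSaddle I.Θ I.Ω (objective f Ξ) L μ)
    (ho : BoundedOracle I.Θ I.Ω f Ξ G) (hv : 0 ≤ v) (hκ : 0 < I.κ) (hη : 0 < I.η)
    (hJ : J₀ ≤ primalValue (objective f Ξ) I.Ω I.θ₀) {Δ : ℝ}
    (hΔ : primalValue (objective f Ξ) I.Ω I.θ₀ - J₀ ≤ Δ)
    (hθ : I.θ₀ ∈ I.Θ) (hω : I.ω₀ ∈ I.Ω) :
    ∫⁻ z, ENNReal.ofReal (lyapunov I (objective f Ξ) L μ J₀ (init I f z.1 z.2.1 z.2.2))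
        ∂(stepLaw d Ξ v)
      ≤ ENNReal.ofReal (Δ + 4 * I.κ * L ^ 2 / (I.η * μ) * (G / μ) ^ 2
          + 4 * I.κ * L ^ 2 / μ ^ 2 * (2 * G ^ 2 + 2 * (d * v))) := by
  have hμ := h.pos
  have hL := h.pos'
  set F := objective f Ξ with hF
  set a := 4 * I.κ * L ^ 2 / (I.η * μ) with ha
  set b := 4 * I.κ * L ^ 2 / μ ^ 2 with hb
  have ha0 : 0 ≤ a := by positivity
  have hb0 : 0 ≤ b := by positivity
  set K := primalValue F I.Ω I.θ₀ - J₀ + a * ‖I.ω₀ - dualArgmax F I.Ω I.θ₀‖ ^ 2 with hKdef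
  have hK : 0 ≤ K := add_nonneg (sub_nonneg.2 hJ) (by positivity)
  have hst := ho.lintegral_errors_le hv hθ hω hK hb0 0 0 1
  have e : ∀ z : 𝒳 × Vec d × Vec d, lyapunov I F L μ J₀ (init I f z.1 z.2.1 z.2.2)
      = K + b * (‖0 + (1 : ℝ) • (gradPrimal F I.θ₀ I.ω₀ - gradPrimal (lossAt f z.1) I.θ₀ I.ω₀)
          - z.2.1‖ ^ 2
        + ‖0 + (1 : ℝ) • (gradDual F I.θ₀ I.ω₀ - gradDual (lossAt f z.1) I.θ₀ I.ω₀)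
          - z.2.2‖ ^ 2) := by
    intro z
    simp only [lyapunov, potential, init, queryPrimal, queryDual]
    rw [← ha, ← hb, hKdef]
    simp only [zero_add, one_smul, sub_add_eq_sub_sub]
    ring
  simp_rw [e]
  refine hst.trans (ENNReal.ofReal_le_ofReal ?_)
  have h1 : ‖I.ω₀ - dualArgmax F I.Ω I.θ₀‖ ^ 2 ≤ (G / μ) ^ 2 := by
    refine pow_le_pow_left₀ (norm_nonneg _) ((h.dist_argmax_le hθ hω).trans ?_) 2
    exact div_le_div_of_nonneg_right (ho.norm_gradDual_le hθ hω) hμ.le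
  have h2 := mul_le_mul_of_nonneg_left h1 ha0
  simp only [norm_zero]
  linarith

end ExpectedStep

/-! ### Continuity in the feasible variables and measurability of one iteration -/

section Measurability

variable {d : ℕ} {Θ Ω : Set (Vec d)} {F : Vec d → Vec d → ℝ} {L μ : ℝ}

namespace SmoothSaddle

lemma continuous_objective (h : SmoothSaddle Θ Ω F L μ) :
    Continuous fun x : Θ × Ω => F x.1 x.2 := by
  refine continuous_iff_continuousAt.2 fun x => ?_
  exact (h.diff x.1 x.1.2 x.2 x.2.2).continuousAt.comp
    (f := fun x : Θ × Ω => ((x.1 : Vec d), (x.2 : Vec d))) (by fun_prop)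

lemma norm_grad_sub_le (h : SmoothSaddle Θ Ω F L μ) (x y : Θ × Ω) :
    ‖gradPrimal F x.1 x.2 - gradPrimal F y.1 y.2‖ ≤ 2 * L * dist x y ∧
      ‖gradDual F x.1 x.2 - gradDual F y.1 y.2‖ ≤ 2 * L * dist x y := by
  have h1 := h.grad_norm_sq_le x.1.2 y.1.2 x.2.2 y.2.2
  have h2 : ‖(x.1 : Vec d) - y.1‖ ≤ dist x y := by
    rw [← dist_eq_norm]; exact le_max_left _ _
  have h3 : ‖(x.2 : Vec d) - y.2‖ ≤ dist x y := by
    rw [← dist_eq_norm]; exact le_max_right _ _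
  -- The product `Θ × Ω` carries the sup distance, so the `ℓ²` Lipschitz constant `L` becomes `√2
  -- L`, rounded up to `2L`.
  have h4 : L ^ 2 * (‖(x.1 : Vec d) - y.1‖ ^ 2 + ‖(x.2 : Vec d) - y.2‖ ^ 2)
      ≤ (2 * L * dist x y) ^ 2 := by
    have : L ^ 2 * (‖(x.1 : Vec d) - y.1‖ ^ 2 + ‖(x.2 : Vec d) - y.2‖ ^ 2)
      ≤ L ^ 2 * (dist x y ^ 2 + dist x y ^ 2) := by gcongr
    nlinarith [sq_nonneg (L * dist x y)]
  have h5 : 0 ≤ 2 * L * dist x y := mul_nonneg (by linarith [h.pos']) dist_nonneg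
  constructor
  · refine le_of_sq_le_sq ?_ h5
    nlinarith [sq_nonneg ‖gradDual F x.1 x.2 - gradDual F y.1 y.2‖]
  · refine le_of_sq_le_sq ?_ h5
    nlinarith [sq_nonneg ‖gradPrimal F x.1 x.2 - gradPrimal F y.1 y.2‖]

lemma continuous_gradPrimal (h : SmoothSaddle Θ Ω F L μ) :
    Continuous fun x : Θ × Ω => gradPrimal F x.1 x.2 :=
  (LipschitzWith.of_dist_le_mul (K := (2 * L).toNNReal) fun x y => by
    rw [Real.coe_toNNReal _ (by linarith [h.pos']), dist_eq_norm]
    exact (h.norm_grad_sub_le x y).1).continuous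

lemma continuous_gradDual (h : SmoothSaddle Θ Ω F L μ) :
    Continuous fun x : Θ × Ω => gradDual F x.1 x.2 :=
  (LipschitzWith.of_dist_le_mul (K := (2 * L).toNNReal) fun x y => by
    rw [Real.coe_toNNReal _ (by linarith [h.pos']), dist_eq_norm]
    exact (h.norm_grad_sub_le x y).2).continuous

lemma continuous_argmax (h : SmoothSaddle Θ Ω F L μ) :
    Continuous fun θ : Θ => dualArgmax F Ω θ :=
  (LipschitzWith.of_dist_le_mul (K := (L / μ).toNNReal) fun x y => by
    rw [Real.coe_toNNReal _ (div_nonneg h.pos'.le h.pos.le), dist_eq_norm]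
    exact h.argmax_lip x.2 y.2).continuous

lemma continuous_primalValue (h : SmoothSaddle Θ Ω F L μ) :
    Continuous fun θ : Θ => primalValue F Ω θ := by
  have h1 : Continuous fun θ : Θ => (θ, (⟨dualArgmax F Ω θ, h.argmax_mem θ.2⟩ : Ω)) :=
    continuous_id.prodMk (h.continuous_argmax.subtype_mk _)
  refine (h.continuous_objective.comp h1).congr fun θ => ?_
  exact (h.primalValue_eq θ.2).symm

end SmoothSaddle

/-- Feasible states of the algorithm, without the query counter. -/
abbrev Feasible (Θ Ω : Set (Vec d)) : Type := Θ × Ω × Vec d × Vec d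

/-- A feasible state as a state of the algorithm. -/
def Feasible.toState (x : Feasible Θ Ω) : State d := ⟨x.1, x.2.1, x.2.2.1, x.2.2.2, 0⟩

/-- The feasible state underlying a state whose iterates are in `Θ` and `Ω`. -/
def Feasible.ofState (s : State d) (hθ : s.θ ∈ Θ) (hω : s.ω ∈ Ω) : Feasible Θ Ω :=
  (⟨s.θ, hθ⟩, ⟨s.ω, hω⟩, s.p, s.q)

variable {I : Input d}

lemma measurable_tildePrimal (h : SmoothSaddle I.Θ I.Ω F L μ) :
    Measurable fun x : Feasible I.Θ I.Ω => tildePrimal I x.toState := by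
  -- Only `Ω` is known to be nonempty here; for empty `Θ` there are no feasible states.
  by_cases hne : I.Θ.Nonempty
  · have := (continuous_proj h.closed_primal h.convex_primal hne).measurable
    refine this.comp (g := proj I.Θ) (f := fun x : Feasible I.Θ I.Ω =>
      (x.1 : Vec d) - I.κ • x.2.2.1) ?_
    fun_prop
  · have : IsEmpty (Feasible I.Θ I.Ω) := ⟨fun x => hne ⟨x.1, x.1.2⟩⟩
    exact measurable_of_empty _

lemma measurable_tildeDual (h : SmoothSaddle I.Θ I.Ω F L μ) :
    Measurable fun x : Feasible I.Θ I.Ω => tildeDual I x.toState := by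
  have := (continuous_proj h.closed_dual h.convex_dual h.nonempty_dual).measurable
  refine this.comp (g := proj I.Ω) (f := fun x : Feasible I.Θ I.Ω =>
    (x.2.1 : Vec d) + I.η • x.2.2.2) ?_
  fun_prop

lemma measurable_gradPrimal_feasible (h : SmoothSaddle Θ Ω F L μ) :
    Measurable fun x : Feasible Θ Ω => gradPrimal F x.1 x.2.1 :=
  h.continuous_gradPrimal.measurable.comp
    (by fun_prop : Measurable fun x : Feasible Θ Ω => (x.1, x.2.1))

lemma measurable_gradDual_feasible (h : SmoothSaddle Θ Ω F L μ) :
    Measurable fun x : Feasible Θ Ω => gradDual F x.1 x.2.1 :=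
  h.continuous_gradDual.measurable.comp
    (by fun_prop : Measurable fun x : Feasible Θ Ω => (x.1, x.2.1))

lemma measurable_argmax_feasible (h : SmoothSaddle Θ Ω F L μ) :
    Measurable fun x : Feasible Θ Ω => dualArgmax F Ω x.1 :=
  h.continuous_argmax.measurable.comp measurable_fst

lemma measurable_metric (h : SmoothSaddle I.Θ I.Ω F L μ) :
    Measurable fun x : Feasible I.Θ I.Ω => metric I F L x.toState := by
  have h1 := measurable_tildePrimal h
  have h2 := measurable_gradPrimal_feasible h
  have h3 := measurable_argmax_feasible h
  have hθ : Measurable fun x : Feasible I.Θ I.Ω => (x.1 : Vec d) := by fun_prop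
  have hω : Measurable fun x : Feasible I.Θ I.Ω => (x.2.1 : Vec d) := by fun_prop
  have hp : Measurable fun x : Feasible I.Θ I.Ω => x.2.2.1 := by fun_prop
  exact (((h1.sub hθ).norm.const_mul _).add (h2.sub hp).norm).add ((hω.sub h3).norm.const_mul _)

lemma measurable_metricSq (h : SmoothSaddle I.Θ I.Ω F L μ) :
    Measurable fun x : Feasible I.Θ I.Ω => metricSq I F L x.toState := by
  have h1 := measurable_tildePrimal h
  have h2 := measurable_gradPrimal_feasible h
  have h3 := measurable_argmax_feasible h
  have hθ : Measurable fun x : Feasible I.Θ I.Ω => (x.1 : Vec d) := by fun_prop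
  have hω : Measurable fun x : Feasible I.Θ I.Ω => (x.2.1 : Vec d) := by fun_prop
  have hp : Measurable fun x : Feasible I.Θ I.Ω => x.2.2.1 := by fun_prop
  exact ((((h1.sub hθ).norm.const_mul _).pow_const 2).add ((h2.sub hp).norm.pow_const 2)).add
    (((hω.sub h3).norm.const_mul _).pow_const 2)

lemma measurable_lyapunov (h : SmoothSaddle I.Θ I.Ω F L μ) (J₀ : ℝ) :
    Measurable fun x : Feasible I.Θ I.Ω => lyapunov I F L μ J₀ x.toState := by
  have h1 : Measurable fun x : Feasible I.Θ I.Ω => primalValue F I.Ω x.1 :=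
    h.continuous_primalValue.measurable.comp measurable_fst
  have h2 := measurable_gradPrimal_feasible h
  have h2' := measurable_gradDual_feasible h
  have h3 := measurable_argmax_feasible h
  have hω : Measurable fun x : Feasible I.Θ I.Ω => (x.2.1 : Vec d) := by fun_prop
  have hp : Measurable fun x : Feasible I.Θ I.Ω => x.2.2.1 := by fun_prop
  have hq : Measurable fun x : Feasible I.Θ I.Ω => x.2.2.2 := by fun_prop
  exact ((h1.add (((hω.sub h3).norm.pow_const 2).const_mul _)).add
    ((((h2.sub hp).norm.pow_const 2).add ((h2'.sub hq).norm.pow_const 2)).const_mul _)).sub_const _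

variable {𝒳 : Type*} [MeasurableSpace 𝒳] {f : Vec d → Vec d → 𝒳 → ℝ} {Ξ : Measure 𝒳} {G : ℝ}

/-- One iteration as a map of feasible states. -/
noncomputable def stepFeasible (h : SmoothSaddle I.Θ I.Ω F L μ) (f : Vec d → Vec d → 𝒳 → ℝ) {t : ℕ}
    (hν : 0 ≤ I.ν t) (hν1 : I.ν t ≤ 1) (x : Feasible I.Θ I.Ω × 𝒳 × Vec d × Vec d) :
    Feasible I.Θ I.Ω :=
  Feasible.ofState (step I f t x.1.toState x.2.1 x.2.2.1 x.2.2.2)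
    (step_mem_primal h hν hν1 (s := x.1.toState) x.1.1.2)
    (step_mem_dual h hν hν1 (s := x.1.toState) x.1.2.1.2)

lemma measurable_stepFeasible (h : SmoothSaddle I.Θ I.Ω F L μ) (ho : BoundedOracle I.Θ I.Ω f Ξ G)
    {t : ℕ} (hν : 0 ≤ I.ν t) (hν1 : I.ν t ≤ 1) :
    Measurable (stepFeasible h f hν hν1) := by
  have hθ : Measurable fun x : Feasible I.Θ I.Ω × 𝒳 × Vec d × Vec d =>
      (⟨x.1.1 + I.ν t • (tildePrimal I x.1.toState - x.1.1),
        step_mem_primal h hν hν1 (s := x.1.toState) x.1.1.2⟩ : I.Θ) := by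
    have := (measurable_tildePrimal h).comp (by fun_prop :
      Measurable fun x : Feasible I.Θ I.Ω × 𝒳 × Vec d × Vec d => x.1)
    have h0 : Measurable fun x : Feasible I.Θ I.Ω × 𝒳 × Vec d × Vec d => (x.1.1 : Vec d) := by
      fun_prop
    exact (h0.add ((this.sub h0).const_smul (I.ν t))).subtype_mk
  have hω : Measurable fun x : Feasible I.Θ I.Ω × 𝒳 × Vec d × Vec d =>
      (⟨x.1.2.1 + I.ν t • (tildeDual I x.1.toState - x.1.2.1),
        step_mem_dual h hν hν1 (s := x.1.toState) x.1.2.1.2⟩ : I.Ω) := by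
    have := (measurable_tildeDual h).comp (by fun_prop :
      Measurable fun x : Feasible I.Θ I.Ω × 𝒳 × Vec d × Vec d => x.1)
    have h0 : Measurable fun x : Feasible I.Θ I.Ω × 𝒳 × Vec d × Vec d => (x.1.2.1 : Vec d) := by
      fun_prop
    exact (h0.add ((this.sub h0).const_smul (I.ν t))).subtype_mk
  have hξ : Measurable fun x : Feasible I.Θ I.Ω × 𝒳 × Vec d × Vec d => x.2.1 := by fun_prop
  have hgp := ho.measurable_primal.comp (hθ.prodMk (hω.prodMk hξ))
  have hgd := ho.measurable_dual.comp (hθ.prodMk (hω.prodMk hξ))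
  have hp : Measurable fun x : Feasible I.Θ I.Ω × 𝒳 × Vec d × Vec d => x.1.2.2.1 := by fun_prop
  have hq : Measurable fun x : Feasible I.Θ I.Ω × 𝒳 × Vec d × Vec d => x.1.2.2.2 := by fun_prop
  have hup : Measurable fun x : Feasible I.Θ I.Ω × 𝒳 × Vec d × Vec d => x.2.2.1 := by fun_prop
  have hud : Measurable fun x : Feasible I.Θ I.Ω × 𝒳 × Vec d × Vec d => x.2.2.2 := by fun_prop
  exact hθ.prodMk (hω.prodMk
    (((((hp.const_smul (1 - I.α * I.ν t)).add (hgp.const_smul (I.α * I.ν t))).add hup)).prodMk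
    ((((hq.const_smul (1 - I.β * I.ν t)).add (hgd.const_smul (I.β * I.ν t))).add hud))))

/-- The initialization as a feasible state. -/
noncomputable def initFeasible (f : Vec d → Vec d → 𝒳 → ℝ) (hθ : I.θ₀ ∈ I.Θ) (hω : I.ω₀ ∈ I.Ω)
    (z : 𝒳 × Vec d × Vec d) : Feasible I.Θ I.Ω :=
  Feasible.ofState (init I f z.1 z.2.1 z.2.2) hθ hω

lemma measurable_initFeasible (ho : BoundedOracle I.Θ I.Ω f Ξ G) (hθ : I.θ₀ ∈ I.Θ)
    (hω : I.ω₀ ∈ I.Ω) : Measurable (initFeasible f hθ hω) := by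
  have hξ : Measurable fun z : 𝒳 × Vec d × Vec d => z.1 := by fun_prop
  have hgp := (ho.measurable_primal_data _ hθ _ hω).comp hξ
  have hgd := (ho.measurable_dual_data _ hθ _ hω).comp hξ
  have hup : Measurable fun z : 𝒳 × Vec d × Vec d => z.2.1 := by fun_prop
  have hud : Measurable fun z : 𝒳 × Vec d × Vec d => z.2.2 := by fun_prop
  have h1 : Measurable fun _ : 𝒳 × Vec d × Vec d => (⟨I.θ₀, hθ⟩ : I.Θ) := measurable_const
  have h2 : Measurable fun _ : 𝒳 × Vec d × Vec d => (⟨I.ω₀, hω⟩ : I.Ω) := measurable_const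
  exact h1.prodMk (h2.prodMk ((hgp.add hup).prodMk (hgd.add hud)))

end Measurability

/-! ### Adaptedness of the iterates, fresh draws and the random output index -/

section Iterates

variable {d : ℕ} {𝒳 : Type*} {f : Vec d → Vec d → 𝒳 → ℝ} {F : Vec d → Vec d → ℝ}
  {L μ G v : ℝ} {I : Input d}

/-- The iterates as feasible states, driven by the sequence `z` of data points and noises. -/
noncomputable def runFeasible (h : SmoothSaddle I.Θ I.Ω F L μ) (f : Vec d → Vec d → 𝒳 → ℝ)
    (hν : ∀ t, 0 ≤ I.ν t) (hν1 : ∀ t, I.ν t ≤ 1) (hθ : I.θ₀ ∈ I.Θ) (hω : I.ω₀ ∈ I.Ω)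
    (z : ℕ → 𝒳 × Vec d × Vec d) : ℕ → Feasible I.Θ I.Ω
  | 0 => initFeasible f hθ hω (z 0)
  | t + 1 => stepFeasible h f (hν t) (hν1 t) (runFeasible h f hν hν1 hθ hω z t, z (t + 1))

/-- The query counter never influences the iterates, so it can be dropped from the feasible states
and restored here. -/
lemma runFeasible_toState (h : SmoothSaddle I.Θ I.Ω F L μ) (f : Vec d → Vec d → 𝒳 → ℝ)
    (hν : ∀ t, 0 ≤ I.ν t) (hν1 : ∀ t, I.ν t ≤ 1) (hθ : I.θ₀ ∈ I.Θ) (hω : I.ω₀ ∈ I.Ω)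
    (z : ℕ → 𝒳 × Vec d × Vec d) (t : ℕ) :
    run I f (fun t => (z t).1) (fun t => (z t).2.1) (fun t => (z t).2.2) t
      = { (runFeasible h f hν hν1 hθ hω z t).toState with evals := 2 * (t + 1) } := by
  induction t with
  | zero => rfl
  | succ t ih =>
    rw [run, ih]
    rfl

variable [MeasurableSpace 𝒳] {Ξ : Measure 𝒳} {W : Type*}

/-- The history of a process up to time `t`. -/
abbrev history {W Z : Type*} [MeasurableSpace Z] (ζ : ℕ → W → Z) (t : ℕ) : MeasurableSpace W :=
  ⨆ s ∈ Set.Iic t, MeasurableSpace.comap (ζ s) inferInstance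

lemma measurable_history {W Z : Type*} [MeasurableSpace Z] (ζ : ℕ → W → Z) {s t : ℕ} (hst : s ≤ t) :
    Measurable[history ζ t] (ζ s) :=
  (comap_measurable (ζ s)).mono
    (le_iSup₂_of_le (f := fun s (_ : s ∈ Set.Iic t) => MeasurableSpace.comap (ζ s) inferInstance)
      s hst le_rfl) le_rfl

lemma history_mono {W Z : Type*} [MeasurableSpace Z] (ζ : ℕ → W → Z) {s t : ℕ} (hst : s ≤ t) :
    history ζ s ≤ history ζ t :=
  biSup_mono fun _ hr => le_trans hr hst

/-- The output index is independent of the whole driving sequence; this makes independence apply to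
quantities that depend on finitely many draws. -/
lemma history_le_comap {W Z : Type*} [MeasurableSpace Z] (ζ : ℕ → W → Z) (t : ℕ) :
    history ζ t ≤ MeasurableSpace.comap (fun w s => ζ s w) MeasurableSpace.pi := by
  refine iSup₂_le fun s _ => ?_
  exact ((measurable_pi_apply s).comp (comap_measurable (fun w s => ζ s w))).comap_le

lemma measurable_runFeasible_history (h : SmoothSaddle I.Θ I.Ω F L μ)
    (ho : BoundedOracle I.Θ I.Ω f Ξ G) (hν : ∀ t, 0 ≤ I.ν t) (hν1 : ∀ t, I.ν t ≤ 1)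
    (hθ : I.θ₀ ∈ I.Θ) (hω : I.ω₀ ∈ I.Ω) (ζ : ℕ → W → 𝒳 × Vec d × Vec d) (t : ℕ) :
    Measurable[history ζ t] fun w => runFeasible h f hν hν1 hθ hω (fun s => ζ s w) t := by
  induction t with
  | zero => exact (measurable_initFeasible ho hθ hω).comp (measurable_history ζ le_rfl)
  | succ t ih =>
    exact (measurable_stepFeasible h ho (hν t) (hν1 t)).comp
      ((ih.mono (history_mono ζ t.le_succ) le_rfl).prodMk (measurable_history ζ le_rfl))

variable [MeasurableSpace W] {P : Measure W} {T : ℕ} {R : W → ℕ}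

/-- The past uses the indices up to `t` and the next draw only `t + 1`; disjoint index blocks of an
independent family are independent. -/
lemma indepFun_next {Z E : Type*} [MeasurableSpace Z] [MeasurableSpace E] {ζ : ℕ → W → Z}
    (hζ : ∀ t, Measurable (ζ t)) (hi : iIndepFun ζ P) {t : ℕ} {X : W → E}
    (hX : Measurable[history ζ t] X) : IndepFun X (ζ (t + 1)) P := by
  have h1 := indep_iSup_of_disjoint (fun s => (hζ s).comap_le) hi.iIndep
    (S := Set.Iic t) (T := {t + 1}) (by simp)
  rw [iSup_singleton] at h1
  exact (IndepFun_iff_Indep _ _ _).2 (indep_of_indep_of_le_left h1 hX.comap_le)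

/-- Averaging over an independent uniform index. -/
lemma lintegral_uniform_index [IsProbabilityMeasure P] {E : Type*} [mE : MeasurableSpace E]
    {Z : W → E} (hZ : Measurable Z) (hR : Measurable R) (hlaw : P.map R = uniformOn (Set.Iio T))
    (hi : IndepFun R Z P) {g : ℕ → W → ℝ≥0∞}
    (hg : ∀ t, Measurable[MeasurableSpace.comap Z mE] (g t)) :
    ∫⁻ w, g (R w) w ∂P = (T : ℝ≥0∞)⁻¹ * ∑ t ∈ Finset.range T, ∫⁻ w, g t w ∂P := by
  have hprob : ∀ t ∈ Finset.range T, P (R ⁻¹' {t}) = (T : ℝ≥0∞)⁻¹ := by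
    intro t ht
    rw [← Measure.map_apply hR (measurableSet_singleton t), hlaw, uniformOn,
      cond_apply measurableSet_Iio, Set.inter_eq_right.2
        (Set.singleton_subset_iff.2 (Set.mem_Iio.2 (Finset.mem_range.1 ht))), Measure.count_singleton, mul_one,
      Measure.count_apply_finite _ (Set.finite_Iio T)]
    simp
  have hlt : ∀ᵐ w ∂P, R w < T := by
    have : ∀ᵐ t ∂(P.map R), t ∈ Set.Iio T := by
      rw [hlaw]
      exact ae_cond_mem measurableSet_Iio
    exact ae_of_ae_map hR.aemeasurable this
  have hgm : ∀ t, Measurable (g t) := fun t => (hg t).mono hZ.comap_le le_rfl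
  have hind : ∀ t, Measurable[MeasurableSpace.comap R inferInstance]
      ((R ⁻¹' {t}).indicator fun _ => (1 : ℝ≥0∞)) := fun t =>
    Measurable.indicator measurable_const ⟨{t}, measurableSet_singleton t, rfl⟩
  -- Splitting over the values of the index replaces a random time by a finite sum of products of
  -- independent factors.
  have e : ∀ᵐ w ∂P, g (R w) w
      = ∑ t ∈ Finset.range T, (R ⁻¹' {t}).indicator (fun _ => (1 : ℝ≥0∞)) w * g t w := by
    filter_upwards [hlt] with w hw
    rw [Finset.sum_eq_single_of_mem (R w) (Finset.mem_range.2 hw)]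
    · simp
    · intro t _ ht
      rw [Set.indicator_of_notMem, zero_mul]
      simpa using ht.symm
  have hprod : ∀ t, Measurable fun w => (R ⁻¹' {t}).indicator (fun _ => (1 : ℝ≥0∞)) w * g t w :=
    fun t => ((hind t).mono hR.comap_le le_rfl).mul (hgm t)
  rw [lintegral_congr_ae e, lintegral_finsetSum _ fun t _ => hprod t, Finset.mul_sum]
  refine Finset.sum_congr rfl fun t ht => ?_
  rw [lintegral_mul_eq_lintegral_mul_lintegral_of_independent_measurableSpace hR.comap_le
    hZ.comap_le ((IndepFun_iff_Indep _ _ _).1 hi) (hind t) (hg t),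
    lintegral_indicator_const (hR (measurableSet_singleton t)), one_mul, hprob t ht]

end Iterates

/-! ### Telescoping the Lyapunov inequality along the run -/

/-- The step size conditions under which the Lyapunov function decreases. -/
structure Admissible {d : ℕ} (I : Input d) (L μ : ℝ) : Prop where
  α_eq : I.α = 3
  β_eq : I.β = 3
  κ_pos : 0 < I.κ
  η_pos : 0 < I.η
  η_le : I.η ≤ μ / (4 * L ^ 2)
  κ_le : I.κ ≤ I.η * μ ^ 2 / (9 * L ^ 2)
  ν_pos : ∀ t, 0 < I.ν t
  ν_le : ∀ t, I.ν t ≤ 1 / 6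
  θ_mem : I.θ₀ ∈ I.Θ
  ω_mem : I.ω₀ ∈ I.Ω

lemma Admissible.ν_nonneg {d : ℕ} {I : Input d} {L μ : ℝ} (h : Admissible I L μ) (t : ℕ) :
    0 ≤ I.ν t := (h.ν_pos t).le

lemma Admissible.ν_le_one {d : ℕ} {I : Input d} {L μ : ℝ} (h : Admissible I L μ) (t : ℕ) :
    I.ν t ≤ 1 := (h.ν_le t).trans (by norm_num)

section Convergence

variable {d : ℕ} {𝒳 : Type*} [MeasurableSpace 𝒳] {f : Vec d → Vec d → 𝒳 → ℝ} {Ξ : Measure 𝒳}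
  {L μ G v J₀ Δ : ℝ} {I : Input d} {W : Type*}

/-- The feasible states visited by an admissible run. -/
noncomputable def visited (h : SmoothSaddle I.Θ I.Ω (objective f Ξ) L μ) (ha : Admissible I L μ)
    (ζ : ℕ → W → 𝒳 × Vec d × Vec d) (t : ℕ) (w : W) : Feasible I.Θ I.Ω :=
  runFeasible h f ha.ν_nonneg ha.ν_le_one ha.θ_mem ha.ω_mem (fun s => ζ s w) t

variable [MeasurableSpace W] {P : Measure W} {T : ℕ} {ζ : ℕ → W → 𝒳 × Vec d × Vec d}

lemma measurable_visited (h : SmoothSaddle I.Θ I.Ω (objective f Ξ) L μ)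
    (ho : BoundedOracle I.Θ I.Ω f Ξ G) (ha : Admissible I L μ) (hζ : ∀ t, Measurable (ζ t)) (t : ℕ) :
    Measurable (visited h ha ζ t) :=
  (measurable_runFeasible_history h ho ha.ν_nonneg ha.ν_le_one ha.θ_mem ha.ω_mem ζ t).mono
    (iSup₂_le fun s _ => (hζ s).comap_le) le_rfl

/-- By independence the joint law of the current state and the next draw is a product. Tonelli then
integrates the draw first, at a fixed state, where the one-step inequality applies. -/
lemma lintegral_lyapunov_succ [IsProbabilityMeasure Ξ] [IsProbabilityMeasure P]
    (h : SmoothSaddle I.Θ I.Ω (objective f Ξ) L μ)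
    (ho : BoundedOracle I.Θ I.Ω f Ξ G) (ha : Admissible I L μ) (hv : 0 ≤ v)
    (hJ : ∀ θ ∈ I.Θ, J₀ ≤ primalValue (objective f Ξ) I.Ω θ) (hζ : ∀ t, Measurable (ζ t))
    (hlaw : ∀ t, P.map (ζ t) = stepLaw d Ξ v) (hi : iIndepFun ζ P) (t : ℕ) :
    ∫⁻ w, ENNReal.ofReal
        (lyapunov I (objective f Ξ) L μ J₀ (visited h ha ζ (t + 1) w).toState) ∂P
      + ∫⁻ w, ENNReal.ofReal (I.κ / 4 * I.ν t
          * metricSq I (objective f Ξ) L (visited h ha ζ t w).toState) ∂P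
      ≤ ∫⁻ w, ENNReal.ofReal (lyapunov I (objective f Ξ) L μ J₀ (visited h ha ζ t w).toState) ∂P
        + ENNReal.ofReal (4 * I.κ * L ^ 2 / μ ^ 2 * (18 * I.ν t ^ 2 * G ^ 2 + 2 * (d * v))) := by
  set F := objective f Ξ with hF
  have hX := measurable_visited h ho ha hζ t
  have hind : IndepFun (visited h ha ζ t) (ζ (t + 1)) P := indepFun_next hζ hi
    (measurable_runFeasible_history h ho ha.ν_nonneg ha.ν_le_one ha.θ_mem ha.ω_mem ζ t)
  have hjoint : P.map (fun w => (visited h ha ζ t w, ζ (t + 1) w))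
      = (P.map (visited h ha ζ t)).prod (stepLaw d Ξ v) := by
    rw [(indepFun_iff_map_prod_eq_prod_map_map hX.aemeasurable (hζ _).aemeasurable).1 hind, hlaw]
  have hstep := measurable_stepFeasible h ho (ha.ν_nonneg t) (ha.ν_le_one t)
  have hV := ((measurable_lyapunov h J₀).comp hstep).ennreal_ofReal
  have hM := ((measurable_metricSq h).const_mul (I.κ / 4 * I.ν t)).ennreal_ofReal
  have e1 : ∫⁻ w, ENNReal.ofReal (lyapunov I F L μ J₀ (visited h ha ζ (t + 1) w).toState) ∂P
      = ∫⁻ x, ∫⁻ z, ENNReal.ofReal (lyapunov I F L μ J₀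
          (step I f t x.toState z.1 z.2.1 z.2.2)) ∂(stepLaw d Ξ v) ∂(P.map (visited h ha ζ t)) := by
    have h1 := lintegral_map hV (hX.prodMk (hζ (t + 1))) (μ := P)
    rw [hjoint, lintegral_prod _ hV.aemeasurable] at h1
    exact h1.symm
  have e2 : ∫⁻ w, ENNReal.ofReal (I.κ / 4 * I.ν t * metricSq I F L (visited h ha ζ t w).toState) ∂P
      = ∫⁻ x, ENNReal.ofReal (I.κ / 4 * I.ν t * metricSq I F L x.toState)
          ∂(P.map (visited h ha ζ t)) := (lintegral_map hM hX).symm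
  have e3 : ∫⁻ w, ENNReal.ofReal (lyapunov I F L μ J₀ (visited h ha ζ t w).toState) ∂P
      = ∫⁻ x, ENNReal.ofReal (lyapunov I F L μ J₀ x.toState) ∂(P.map (visited h ha ζ t)) :=
    (lintegral_map (measurable_lyapunov h J₀).ennreal_ofReal hX).symm
  have : IsProbabilityMeasure (P.map (visited h ha ζ t)) :=
    Measure.isProbabilityMeasure_map hX.aemeasurable
  rw [e1, e2, e3, ← lintegral_add_right _ hM]
  calc _ ≤ ∫⁻ x, (ENNReal.ofReal (lyapunov I F L μ J₀ (Feasible.toState x))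
        + ENNReal.ofReal (4 * I.κ * L ^ 2 / μ ^ 2 * (18 * I.ν t ^ 2 * G ^ 2 + 2 * (d * v))))
        ∂(P.map (visited h ha ζ t)) :=
        lintegral_mono fun x => lintegral_lyapunov_step h ho hv ha.α_eq ha.β_eq ha.κ_pos ha.η_pos
          ha.η_le ha.κ_le hJ (ha.ν_pos t) (ha.ν_le t) (s := x.toState) x.1.2 x.2.1.2
    _ = _ := by rw [lintegral_add_right _ measurable_const]; simp

lemma lintegral_lyapunov_zero_le [IsProbabilityMeasure Ξ] [IsProbabilityMeasure P]
    (h : SmoothSaddle I.Θ I.Ω (objective f Ξ) L μ)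
    (ho : BoundedOracle I.Θ I.Ω f Ξ G) (ha : Admissible I L μ) (hv : 0 ≤ v)
    (hJ : ∀ θ ∈ I.Θ, J₀ ≤ primalValue (objective f Ξ) I.Ω θ)
    (hΔ : primalValue (objective f Ξ) I.Ω I.θ₀ - J₀ ≤ Δ) (hζ : ∀ t, Measurable (ζ t))
    (hlaw : ∀ t, P.map (ζ t) = stepLaw d Ξ v) :
    ∫⁻ w, ENNReal.ofReal (lyapunov I (objective f Ξ) L μ J₀ (visited h ha ζ 0 w).toState) ∂P
      ≤ ENNReal.ofReal (Δ + 4 * I.κ * L ^ 2 / (I.η * μ) * (G / μ) ^ 2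
          + 4 * I.κ * L ^ 2 / μ ^ 2 * (2 * G ^ 2 + 2 * (d * v))) := by
  have hV := ((measurable_lyapunov h J₀).comp
    (measurable_initFeasible ho ha.θ_mem ha.ω_mem)).ennreal_ofReal
  have h1 := lintegral_map hV (hζ 0) (μ := P)
  rw [hlaw] at h1
  exact h1.symm.trans_le (lintegral_lyapunov_init_le h ho hv ha.κ_pos ha.η_pos (hJ _ ha.θ_mem) hΔ
    ha.θ_mem ha.ω_mem)

lemma sum_lintegral_metricSq_le [IsProbabilityMeasure Ξ] [IsProbabilityMeasure P]
    (h : SmoothSaddle I.Θ I.Ω (objective f Ξ) L μ)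
    (ho : BoundedOracle I.Θ I.Ω f Ξ G) (ha : Admissible I L μ) (hv : 0 ≤ v) (hΔ0 : 0 ≤ Δ)
    (hJ : ∀ θ ∈ I.Θ, J₀ ≤ primalValue (objective f Ξ) I.Ω θ)
    (hΔ : primalValue (objective f Ξ) I.Ω I.θ₀ - J₀ ≤ Δ) (hζ : ∀ t, Measurable (ζ t))
    (hlaw : ∀ t, P.map (ζ t) = stepLaw d Ξ v) (hi : iIndepFun ζ P) (T : ℕ) :
    ∑ t ∈ Finset.range T, ∫⁻ w, ENNReal.ofReal (I.κ / 4 * I.ν t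
          * metricSq I (objective f Ξ) L (visited h ha ζ t w).toState) ∂P
      ≤ ENNReal.ofReal (Δ + 4 * I.κ * L ^ 2 / (I.η * μ) * (G / μ) ^ 2
          + 4 * I.κ * L ^ 2 / μ ^ 2 * (2 * G ^ 2 + 2 * (d * v))
          + 4 * I.κ * L ^ 2 / μ ^ 2
            * ∑ t ∈ Finset.range T, (18 * I.ν t ^ 2 * G ^ 2 + 2 * (d * v))) := by
  have hκ := ha.κ_pos
  have hη := ha.η_pos
  have hμ := h.pos
  set b := 4 * I.κ * L ^ 2 / μ ^ 2
  have hb : 0 ≤ b := by positivity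
  have hN : ∀ t, 0 ≤ 18 * I.ν t ^ 2 * G ^ 2 + 2 * (d * v) := fun t => by positivity
  -- The induction needs the terminal Lyapunov value on the left; at the end it is dropped, being
  -- nonnegative.
  have key : ∀ T : ℕ, ∫⁻ w, ENNReal.ofReal
        (lyapunov I (objective f Ξ) L μ J₀ (visited h ha ζ T w).toState) ∂P
      + ∑ t ∈ Finset.range T, ∫⁻ w, ENNReal.ofReal (I.κ / 4 * I.ν t
          * metricSq I (objective f Ξ) L (visited h ha ζ t w).toState) ∂P
      ≤ ENNReal.ofReal (Δ + 4 * I.κ * L ^ 2 / (I.η * μ) * (G / μ) ^ 2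
          + b * (2 * G ^ 2 + 2 * (d * v))
          + b * ∑ t ∈ Finset.range T, (18 * I.ν t ^ 2 * G ^ 2 + 2 * (d * v))) := by
    intro T
    induction T with
    | zero => simpa using lintegral_lyapunov_zero_le h ho ha hv hJ hΔ hζ hlaw
    | succ T ih =>
      have h1 := lintegral_lyapunov_succ h ho ha hv hJ hζ hlaw hi T
      have hS : 0 ≤ ∑ t ∈ Finset.range T, (18 * I.ν t ^ 2 * G ^ 2 + 2 * (d * v)) :=
        Finset.sum_nonneg fun t _ => hN t
      rw [Finset.sum_range_succ, Finset.sum_range_succ, mul_add b (∑ t ∈ Finset.range T, _),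
        ← add_assoc _ (b * ∑ t ∈ Finset.range T, _),
        ENNReal.ofReal_add (by positivity) (mul_nonneg hb (hN T))]
      rw [add_comm (∑ t ∈ Finset.range T, _), ← add_assoc]
      refine (add_le_add_left h1 _).trans ?_
      rw [add_right_comm]
      exact add_le_add_left ih _
  exact le_add_self.trans (key T)

/-- Second moment bound for the metric at an independent uniform index. -/
lemma lintegral_metric_sq_le [IsProbabilityMeasure P]
    (h : SmoothSaddle I.Θ I.Ω (objective f Ξ) L μ)
    (ho : BoundedOracle I.Θ I.Ω f Ξ G) (ha : Admissible I L μ) (hζ : ∀ t, Measurable (ζ t))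
    {R : W → ℕ} (hR : Measurable R) (hRlaw : P.map R = uniformOn (Set.Iio T))
    (hRi : IndepFun R (fun w t => ζ t w) P) (hT : 1 ≤ T) {c Q : ℝ} (hc : 0 < c)
    (hcν : ∀ t < T, c ≤ I.κ / 4 * I.ν t)
    (hQ : ∑ t ∈ Finset.range T, ∫⁻ w, ENNReal.ofReal (I.κ / 4 * I.ν t
      * metricSq I (objective f Ξ) L (visited h ha ζ t w).toState) ∂P ≤ ENNReal.ofReal Q) :
    ∫⁻ w, ENNReal.ofReal (metric I (objective f Ξ) L (visited h ha ζ (R w) w).toState ^ 2) ∂P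
      ≤ ENNReal.ofReal (3 * Q / (c * T)) := by
  set F := objective f Ξ
  have hT0 : (0 : ℝ) < T := by exact_mod_cast hT
  have hmeas := ((measurable_metric h).pow_const 2).ennreal_ofReal
  have hZ : Measurable fun w t => ζ t w := measurable_pi_iff.2 hζ
  rw [lintegral_uniform_index hZ hR hRlaw hRi
    (g := fun t w => ENNReal.ofReal (metric I F L (visited h ha ζ t w).toState ^ 2))
    fun t => hmeas.comp ((measurable_runFeasible_history h ho ha.ν_nonneg ha.ν_le_one ha.θ_mem
      ha.ω_mem ζ t).mono (history_le_comap ζ t) le_rfl)]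
  -- The `3` comes from bounding the square of a sum of three terms; `c` bounds all the weights from
  -- below.
  have h1 : ∀ t ∈ Finset.range T,
      ENNReal.ofReal (c / 3)
        * ∫⁻ w, ENNReal.ofReal (metric I F L (visited h ha ζ t w).toState ^ 2) ∂P
      ≤ ∫⁻ w, ENNReal.ofReal (I.κ / 4 * I.ν t * metricSq I F L (visited h ha ζ t w).toState) ∂P := by
    intro t ht
    have hm : Measurable fun w =>
        ENNReal.ofReal (metric I F L (visited h ha ζ t w).toState ^ 2) :=
      hmeas.comp (measurable_visited h ho ha hζ t)
    rw [← lintegral_const_mul _ hm]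
    refine lintegral_mono fun w => ?_
    rw [← ENNReal.ofReal_mul (by positivity)]
    refine ENNReal.ofReal_le_ofReal ?_
    have h2 := metric_sq_le I F L (visited h ha ζ t w).toState
    have h3 := mul_le_mul_of_nonneg_right (hcν t (Finset.mem_range.1 ht))
      (metricSq_nonneg I F L (visited h ha ζ t w).toState)
    nlinarith
  have h2 := (Finset.sum_le_sum h1).trans hQ
  rw [← Finset.mul_sum] at h2
  have h3 : ∑ t ∈ Finset.range T,
      ∫⁻ w, ENNReal.ofReal (metric I F L (visited h ha ζ t w).toState ^ 2) ∂P
      ≤ ENNReal.ofReal Q / ENNReal.ofReal (c / 3) := by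
    rw [ENNReal.le_div_iff_mul_le (Or.inl (by simpa using hc)) (Or.inl ENNReal.ofReal_ne_top),
      mul_comm]
    exact h2
  calc _ ≤ (T : ℝ≥0∞)⁻¹ * (ENNReal.ofReal Q / ENNReal.ofReal (c / 3)) := by gcongr
    _ = _ := by
      rw [← ENNReal.ofReal_div_of_pos (by positivity), ← ENNReal.ofReal_natCast T,
        ← ENNReal.ofReal_inv_of_pos hT0, ← ENNReal.ofReal_mul (by positivity)]
      congr 1
      field_simp

end Convergence

/-! ### From the second moment to the rate: step sizes, noise level and iteration count -/

lemma integrable_and_integral_le_sqrt {W : Type*} [MeasurableSpace W] {P : Measure W}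
    [IsProbabilityMeasure P] {φ : W → ℝ} (hφ : Measurable φ) {B : ℝ} (hB : 0 ≤ B)
    (h : ∫⁻ w, ENNReal.ofReal (φ w ^ 2) ∂P ≤ ENNReal.ofReal B) :
    Integrable φ P ∧ ∫ w, φ w ∂P ≤ √B := by
  have hsq : Integrable (fun w => φ w ^ 2) P :=
    (lintegral_ofReal_ne_top_iff_integrable (hφ.pow_const 2).aestronglyMeasurable
      (Eventually.of_forall fun w => sq_nonneg _)).1 (h.trans_lt ENNReal.ofReal_lt_top).ne
  have hm : MemLp φ 2 P := (memLp_two_iff_integrable_sq hφ.aestronglyMeasurable).2 hsq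
  refine ⟨hm.integrable one_le_two, Real.le_sqrt_of_sq_le ?_⟩
  -- Nonnegativity of the variance plays the role of Jensen's inequality.
  have h1 := variance_nonneg φ P
  rw [variance_eq_sub hm] at h1
  have h2 : ∫ w, φ w ^ 2 ∂P ≤ B := by
    rw [integral_eq_lintegral_of_nonneg_ae (Eventually.of_forall fun w => sq_nonneg _)
      (hφ.pow_const 2).aestronglyMeasurable]
    exact ENNReal.toReal_le_of_le_ofReal hB h
  have h3 : ∫ w, (φ ^ 2) w ∂P = ∫ w, φ w ^ 2 ∂P := rfl
  linarith

lemma run_evals {d : ℕ} {𝒳 : Type*} (I : Input d) (f : Vec d → Vec d → 𝒳 → ℝ) (ξ : ℕ → 𝒳)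
    (up ud : ℕ → Vec d) (t : ℕ) : (run I f ξ up ud t).evals = 2 * (t + 1) := by
  induction t with
  | zero => rfl
  | succ t ih =>
    simp only [run, step, queryPrimal, queryDual, ih]
    ring

lemma sum_one_div_add_le_log {b : ℝ} (hb : 3 ≤ b) (T : ℕ) :
    ∑ t ∈ Finset.range T, 1 / ((t : ℝ) + b) ≤ Real.log (T + b) := by
  -- The shift by `-1` makes the induction close: each increment is the bound `1 - 1/x ≤ log x` at
  -- `x = (T+b)/(T+b-1)`.
  have key : ∀ T : ℕ, ∑ t ∈ Finset.range T, 1 / ((t : ℝ) + b) ≤ Real.log (T + b - 1) := by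
    intro T
    induction T with
    | zero =>
      simpa using Real.log_nonneg (by linarith : 1 ≤ b - 1)
    | succ T ih =>
      have hT : (0 : ℝ) ≤ T := T.cast_nonneg
      have h1 : 0 < (T : ℝ) + b - 1 := by linarith
      have h2 : 0 < (T : ℝ) + b := by linarith
      have h3 := Real.one_sub_inv_le_log_of_pos (div_pos h2 h1)
      rw [Real.log_div h2.ne' h1.ne', inv_div] at h3
      have h4 : 1 - ((T : ℝ) + b - 1) / (T + b) = 1 / (T + b) := by
        field_simp
        ring
      rw [Finset.sum_range_succ]
      push_cast
      rw [show (T : ℝ) + 1 + b - 1 = T + b by ring]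
      linarith
  refine (key T).trans (Real.log_le_log ?_ (by linarith))
  have : (0 : ℝ) ≤ T := T.cast_nonneg
  linarith

/-- The Rényi order is chosen so that `log(1/δ)/(α' - 1) = (1-β')ε`, which leaves the budget `β'ε`
in the denominator. -/
lemma trajectoryVariance_eq {G β' ε δ : ℝ} (n m T : ℕ) (hβ' : β' < 1)
    (hℓ : 0 < Real.log (1 / δ)) :
    trajectoryVariance G β' ε δ n m T
      = 14 * (n : ℝ) ^ 2 * G ^ 2 * T * (Real.log (1 / δ) / ((1 - β') * ε) + 1)
        / ((m : ℝ) ^ 2 * (β' * ε)) := by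
  have h1 : 0 < 1 - β' := by linarith
  unfold trajectoryVariance renyiOrder
  congr 2
  rw [add_sub_cancel_right, div_div_cancel₀ hℓ.ne']
  ring

lemma trajectoryVariance_nonneg {G β' ε δ : ℝ} (n m T : ℕ) (hβ : 0 < β') (hβ' : β' < 1)
    (hε : 0 < ε) (hℓ : 0 < Real.log (1 / δ)) : 0 ≤ trajectoryVariance G β' ε δ n m T := by
  have h1 : 0 < 1 - β' := by linarith
  rw [trajectoryVariance_eq n m T hβ' hℓ]
  positivity

/-- With the prescribed number of iterations, the total noise is bounded. -/
lemma total_variance_le {G β' ε δ C K : ℝ} {d n m T : ℕ} (hβ : 0 < β') (hβ' : β' < 1)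
    (hε : 0 < ε) (hℓ : 0 < Real.log (1 / δ)) (hC : 0 < C) (hK : 0 < K)
    (hεK : ε ≤ K * Real.log (1 / δ)) (hd : 1 ≤ d) (hn : 1 ≤ n) (hm : 1 ≤ m)
    (hT : (T : ℝ) ≤ 2 * (C * (m * ε / (n * √(d * Real.log (1 / δ)))))) :
    d * trajectoryVariance G β' ε δ n m T * T ≤ 56 * C ^ 2 * G ^ 2 * (1 / (1 - β') + K) / β' := by
  have h1 : 0 < 1 - β' := by linarith
  rw [trajectoryVariance_eq n m T hβ' hℓ]
  set ℓ := Real.log (1 / δ)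
  have hd0 : (0 : ℝ) < d := by exact_mod_cast hd
  have hn0 : (0 : ℝ) < n := by exact_mod_cast hn
  have hm0 : (0 : ℝ) < m := by exact_mod_cast hm
  -- The variance is itself proportional to `T`, so the total noise is quadratic in `T`; squaring
  -- the iteration bound cancels `n`, `d` and `m`.
  have hT2 : (n : ℝ) ^ 2 * d * (T : ℝ) ^ 2 ≤ 4 * C ^ 2 * (m : ℝ) ^ 2 * ε ^ 2 / ℓ := by
    have h2 := pow_le_pow_left₀ T.cast_nonneg hT 2
    have e : (2 * (C * (m * ε / (n * √(d * ℓ))))) ^ 2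
        = 4 * C ^ 2 * (m : ℝ) ^ 2 * ε ^ 2 / (n ^ 2 * (d * ℓ)) := by
      rw [mul_pow, mul_pow, div_pow, mul_pow, mul_pow, Real.sq_sqrt (by positivity)]
      ring
    rw [e, le_div_iff₀ (by positivity)] at h2
    rw [le_div_iff₀ hℓ]
    linarith
  -- The hypothesis `ε ≤ K log(1/δ)` absorbs the additive `1` of the Rényi order.
  have hα : ℓ / ((1 - β') * ε) + 1 ≤ (1 / (1 - β') + K) * (ℓ / ε) := by
    have : 1 ≤ K * (ℓ / ε) := by rw [← mul_div_assoc, one_le_div hε]; exact hεK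
    have e : ℓ / ((1 - β') * ε) = 1 / (1 - β') * (ℓ / ε) := by field_simp
    rw [e, add_mul]
    linarith
  calc _ = 14 * G ^ 2 * (ℓ / ((1 - β') * ε) + 1) / ((m : ℝ) ^ 2 * (β' * ε))
        * ((n : ℝ) ^ 2 * d * (T : ℝ) ^ 2) := by ring
    _ ≤ 14 * G ^ 2 * ((1 / (1 - β') + K) * (ℓ / ε)) / ((m : ℝ) ^ 2 * (β' * ε))
        * (4 * C ^ 2 * (m : ℝ) ^ 2 * ε ^ 2 / ℓ) := by gcongr
    _ = _ := by
      generalize 1 / (1 - β') + K = k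
      field_simp
      ring

lemma sqrt_sqrt_eq_rate {n x y : ℝ} (hn : 0 < n) (hx : 0 < x) (hy : 0 < y) :
    √√(n * √x / y) = n ^ (1 / 4 : ℝ) * x ^ (1 / 8 : ℝ) / y ^ (1 / 4 : ℝ) := by
  have e4 : ∀ z : ℝ, 0 < z → (z ^ (1 / 4 : ℝ)) ^ 4 = z := fun z hz => by
    rw [← Real.rpow_natCast, ← Real.rpow_mul hz.le]
    norm_num
  have e8 : (x ^ (1 / 8 : ℝ)) ^ 4 = √x := by
    rw [← Real.rpow_natCast, ← Real.rpow_mul hx.le, Real.sqrt_eq_rpow]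
    norm_num
  have e : n * √x / y = ((n ^ (1 / 4 : ℝ) * x ^ (1 / 8 : ℝ) / y ^ (1 / 4 : ℝ)) ^ 2) ^ 2 := by
    rw [← pow_mul, div_pow, mul_pow]
    norm_num only
    rw [e4 n hn, e4 y hy, e8]
  rw [e, Real.sqrt_sq (by positivity), Real.sqrt_sq (by positivity)]

/-- The constant in front of the second moment of the metric. -/
noncomputable def momentConst (L μ G κ η Δ c₁ : ℝ) : ℝ :=
  Δ + 4 * κ * L ^ 2 / (η * μ) * (G / μ) ^ 2 + 4 * κ * L ^ 2 / μ ^ 2 * (4 * G ^ 2 + 4 * c₁)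

lemma one_le_log_add {b : ℝ} (hb : 3 ≤ b) {T : ℕ} (hT : 1 ≤ T) : 1 ≤ Real.log (T + b) := by
  have hT0 : (1 : ℝ) ≤ T := by exact_mod_cast hT
  rw [Real.le_log_iff_exp_le (by linarith)]
  linarith [Real.exp_one_lt_d9]

/-- The squared step sizes sum to at most `Λ/16` and the `T` noise terms contribute at most `2c₁`;
all remaining constants are absorbed by `Λ ≥ 1`. -/
lemma accumulated_error_le {L μ G κ η Δ c₁ b V : ℝ} (hμ : 0 < μ) (hκ : 0 < κ) (hη : 0 < η)
    (hΔ : 0 ≤ Δ) (hb : 3 ≤ b) (hV : 0 ≤ V) {T : ℕ} (hT : 1 ≤ T) (hVT : V * T ≤ c₁) :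
    Δ + 4 * κ * L ^ 2 / (η * μ) * (G / μ) ^ 2 + 4 * κ * L ^ 2 / μ ^ 2 * (2 * G ^ 2 + 2 * V)
        + 4 * κ * L ^ 2 / μ ^ 2
          * ∑ t ∈ Finset.range T, (18 * (1 / (4 * √((t : ℝ) + b))) ^ 2 * G ^ 2 + 2 * V)
      ≤ momentConst L μ G κ η Δ c₁ * Real.log (T + b) := by
  have hT0 : (1 : ℝ) ≤ T := by exact_mod_cast hT
  have hΛ := one_le_log_add hb hT
  have hlog := sum_one_div_add_le_log hb T
  set Λ := Real.log (T + b)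
  have hVc : V ≤ c₁ := le_trans (le_mul_of_one_le_right hV hT0) hVT
  have hc : 0 ≤ c₁ := hV.trans hVc
  have hsum : ∑ t ∈ Finset.range T, (18 * (1 / (4 * √((t : ℝ) + b))) ^ 2 * G ^ 2 + 2 * V)
      ≤ 2 * G ^ 2 * Λ + 2 * c₁ := by
    have e : ∀ t ∈ Finset.range T, 18 * (1 / (4 * √((t : ℝ) + b))) ^ 2 * G ^ 2 + 2 * V
        = 18 / 16 * G ^ 2 * (1 / ((t : ℝ) + b)) + 2 * V := by
      intro t _
      have : (0 : ℝ) ≤ t := t.cast_nonneg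
      rw [div_pow, mul_pow, Real.sq_sqrt (by linarith)]
      have : 0 < (t : ℝ) + b := by linarith
      field_simp
      ring
    rw [Finset.sum_congr rfl e, Finset.sum_add_distrib, ← Finset.mul_sum, Finset.sum_const,
      Finset.card_range, nsmul_eq_mul]
    have h1 := mul_le_mul_of_nonneg_left hlog (by positivity : 0 ≤ 18 / 16 * G ^ 2)
    have h2 : 0 ≤ G ^ 2 * Λ := by positivity
    linarith
  unfold momentConst
  set p := 4 * κ * L ^ 2 / (η * μ) * (G / μ) ^ 2
  set q := 4 * κ * L ^ 2 / μ ^ 2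
  have hp : 0 ≤ p := by positivity
  have hq : 0 ≤ q := by positivity
  have h3 := mul_le_mul_of_nonneg_left hsum hq
  have h4 := mul_le_mul_of_nonneg_left hVc hq
  have h5 : 0 ≤ (Δ + p + q * (2 * G ^ 2) + q * (4 * c₁)) * (Λ - 1) :=
    mul_nonneg (by positivity) (by linarith)
  linarith

lemma three_mul_div_le {κ b A Q C r Λ : ℝ} {T : ℕ} (hκ : 0 < κ) (hb : 3 ≤ b) (hT : 1 ≤ T)
    (hA : 0 ≤ A) (hΛ : 0 ≤ Λ) (hQ : Q ≤ A * Λ) (hC : 0 < C) (hr : 0 < r) (hrT : C * r ≤ T + 1) :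
    3 * Q / (κ / 4 * (1 / (4 * √((T : ℝ) + b))) * T)
      ≤ 48 * A * √(1 + b) / κ * √(2 / C) * √(1 / r) * Λ := by
  have hT0 : (1 : ℝ) ≤ T := by exact_mod_cast hT
  have hTb : 0 < (T : ℝ) + b := by linarith
  -- Uses `T + b ≤ T(1 + b)` for `T ≥ 1`; below, `C r ≤ T + 1 ≤ 2T` trades `T` for `r`.
  have h1 : √((T : ℝ) + b) ≤ √T * √(1 + b) := by
    rw [← Real.sqrt_mul (by linarith)]
    exact Real.sqrt_le_sqrt (by nlinarith)
  have h2 : 1 / √(T : ℝ) ≤ √(2 / C) * √(1 / r) := by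
    rw [← Real.sqrt_mul (by positivity), ← Real.sqrt_one, ← Real.sqrt_div zero_le_one,
      Real.sqrt_one]
    refine Real.sqrt_le_sqrt ?_
    rw [div_mul_div_comm, div_le_div_iff₀ (by linarith) (by positivity)]
    linarith
  have h0 : 0 < √(T : ℝ) := Real.sqrt_pos.2 (by linarith)
  calc 3 * Q / (κ / 4 * (1 / (4 * √((T : ℝ) + b))) * T)
      = 48 * Q * √((T : ℝ) + b) / (κ * T) := by
        have : 0 < √((T : ℝ) + b) := Real.sqrt_pos.2 hTb
        have : (0 : ℝ) < T := by linarith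
        field_simp
        ring
    _ ≤ 48 * (A * Λ) * (√T * √(1 + b)) / (κ * T) := by gcongr
    _ = 48 * A * √(1 + b) / κ * (1 / √T) * Λ := by
        have e : (T : ℝ) = √T * √T := (Real.mul_self_sqrt (by linarith)).symm
        rw [show κ * (T : ℝ) = κ * (√T * √T) by rw [← e]]
        field_simp
    _ ≤ 48 * A * √(1 + b) / κ * (√(2 / C) * √(1 / r)) * Λ := by gcongr
    _ = _ := by ring

lemma stepSize_le {b : ℝ} (hb : 3 ≤ b) (t : ℕ) : 1 / (4 * √((t : ℝ) + b)) ≤ 1 / 6 := by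
  have ht : (0 : ℝ) ≤ t := t.cast_nonneg
  -- Since `√3 ≥ 3/2`, the bound `b ≥ 3` gives steps of at most `1/6`.
  have : (3 / 2 : ℝ) ≤ √((t : ℝ) + b) := Real.le_sqrt_of_sq_le (by linarith)
  exact one_div_le_one_div_of_le (by norm_num) (by linarith)

/-- Convergence of DPTD, given the assumptions on the objective and its stochastic gradients. -/
lemma integral_metric_le {d : ℕ} {𝒳 : Type*} [MeasurableSpace 𝒳] {f : Vec d → Vec d → 𝒳 → ℝ}
    {Ξ : Measure 𝒳} [IsProbabilityMeasure Ξ] {L μ G v J₀ Δ b c₁ C r : ℝ} {I : Input d}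
    {W : Type*} [MeasurableSpace W] {P : Measure W} [IsProbabilityMeasure P] {T : ℕ}
    {ξ : ℕ → W → 𝒳} {up ud : ℕ → W → Vec d} {R : W → ℕ}
    (h : SmoothSaddle I.Θ I.Ω (objective f Ξ) L μ) (ho : BoundedOracle I.Θ I.Ω f Ξ G)
    (ha : Admissible I L μ) (hν : I.ν = fun t : ℕ => 1 / (4 * √((t : ℝ) + b))) (hb : 3 ≤ b)
    (hv : 0 ≤ v) (hΔ0 : 0 ≤ Δ) (hJ : ∀ θ ∈ I.Θ, J₀ ≤ primalValue (objective f Ξ) I.Ω θ)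
    (hΔ : primalValue (objective f Ξ) I.Ω I.θ₀ - J₀ ≤ Δ)
    (hR : Randomness P Ξ v T ξ up ud R) (hT : 1 ≤ T) (hvT : d * v * T ≤ c₁)
    (hC : 0 < C) (hr : 0 < r) (hrT : C * r ≤ T + 1) :
    Integrable (fun w => metric I (objective f Ξ) L
      (run I f (fun t => ξ t w) (fun t => up t w) (fun t => ud t w) (R w))) P ∧
    ∫ w, metric I (objective f Ξ) L
      (run I f (fun t => ξ t w) (fun t => up t w) (fun t => ud t w) (R w)) ∂P
      ≤ √(48 * momentConst L μ G I.κ I.η Δ c₁ * √(1 + b) / I.κ * √(2 / C)) * √√(1 / r)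
        * √(Real.log (T + b)) := by
  set ζ : ℕ → W → 𝒳 × Vec d × Vec d := fun t w => (ξ t w, up t w, ud t w) with hζdef
  have hζ : ∀ t, Measurable (ζ t) := fun t =>
    (hR.measurable_data t).prodMk ((hR.measurable_primal t).prodMk (hR.measurable_dual t))
  have hκ := ha.κ_pos
  have hη := ha.η_pos
  have hμ := h.pos
  have hT0 : (1 : ℝ) ≤ T := by exact_mod_cast hT
  have hΛ := one_le_log_add hb hT
  have hc₁ : 0 ≤ c₁ := le_trans (by positivity) hvT
  have hA : 0 ≤ momentConst L μ G I.κ I.η Δ c₁ := by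
    unfold momentConst
    positivity
  have e : ∀ w, metric I (objective f Ξ) L
      (run I f (fun t => ξ t w) (fun t => up t w) (fun t => ud t w) (R w))
      = metric I (objective f Ξ) L (visited h ha ζ (R w) w).toState := by
    intro w
    rw [runFeasible_toState h f ha.ν_nonneg ha.ν_le_one ha.θ_mem ha.ω_mem (fun s => ζ s w) (R w)]
    rfl
  simp_rw [e]
  have hmeas : Measurable fun w =>
      metric I (objective f Ξ) L (visited h ha ζ (R w) w).toState := by
    -- The index set is countable, so measurability at each fixed time suffices for evaluation at a
    -- random time.
    have h1 : Measurable fun p : ℕ × W => visited h ha ζ p.1 p.2 :=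
      measurable_from_prod_countable_right fun t => measurable_visited h ho ha hζ t
    exact (measurable_metric h).comp (h1.comp (hR.measurable_index.prodMk measurable_id))
  have hsum := sum_lintegral_metricSq_le h ho ha hv hΔ0 hJ hΔ hζ hR.law hR.indep T
  have hQ := accumulated_error_le (L := L) (G := G) hμ hκ hη hΔ0 hb
    (by positivity : 0 ≤ d * v) hT hvT
  simp only [hν] at hsum
  have hTb : 0 < (T : ℝ) + b := by linarith
  have hc : 0 < I.κ / 4 * (1 / (4 * √((T : ℝ) + b))) := by
    have := Real.sqrt_pos.2 hTb
    positivity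
  -- The step sizes decrease, so the weight at `T` is a lower bound for all earlier ones.
  have hmom := lintegral_metric_sq_le h ho ha hζ hR.measurable_index hR.law_index hR.indep_index
    hT hc (fun t ht => by
      rw [hν]
      have ht0 : (0 : ℝ) ≤ t := t.cast_nonneg
      have ht' : (t : ℝ) ≤ T := by exact_mod_cast ht.le
      have : 0 < √((t : ℝ) + b) := Real.sqrt_pos.2 (by linarith)
      beta_reduce
      gcongr)
    (by simpa only [hν] using hsum)
  have hB := three_mul_div_le hκ hb hT hA (zero_le_one.trans hΛ) hQ hC hr hrT
  obtain ⟨hint, hle⟩ := integrable_and_integral_le_sqrt hmeas (by positivity)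
    (hmom.trans (ENNReal.ofReal_le_ofReal hB))
  refine ⟨hint, hle.trans_eq ?_⟩
  rw [Real.sqrt_mul (by positivity), Real.sqrt_mul (by positivity)]

end DPTD

/-! ### Choice of the constant and conclusion -/

theorem mainTheorem4
    (LF μ G κ η b β' C K Δ : ℝ)
    (hμ : 0 < μ) (hμLF : μ ≤ LF) (hG : 0 < G)
    (hη : 0 < η) (hη' : η ≤ μ / (4 * LF ^ 2))
    (hκ : 0 < κ) (hκ' : κ ≤ η * μ ^ 2 / (9 * LF ^ 2))
    (hb : max ((2 * κ * LF ^ 2 / μ) ^ 2) 3 ≤ b)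
    (hβ' : 0 < β') (hβ'' : β' < 1) (hC : 0 < C) (hK : 0 < K) (hΔ : 0 ≤ Δ) :
    ∃ A : ℝ, 0 < A ∧
      ∀ (d n m T : ℕ) (ε δ : ℝ) (len : Fin m → ℕ)
        (𝒳 : Type*) [MeasurableSpace 𝒳] (Ξ : Measure 𝒳) [IsProbabilityMeasure Ξ]
        (f : DPTD.Vec d → DPTD.Vec d → 𝒳 → ℝ)
        (Θ Ω : Set (DPTD.Vec d)) (θ₀ ω₀ θopt : DPTD.Vec d)
        (W : Type*) [MeasurableSpace W] (P : Measure W) [IsProbabilityMeasure P]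
        (ξ : ℕ → W → 𝒳) (up ud : ℕ → W → DPTD.Vec d) (R : W → ℕ) (I : DPTD.Input d),
        -- sizes, privacy budget and number of iterations
        1 ≤ d → 1 ≤ n → IsGreatest (Set.range len) n →
        0 < ε → 0 < δ → δ < 1 → ε ≤ K * Real.log (1 / δ) →
        1 ≤ C * m * ε / (n * √(d * Real.log (1 / δ))) →
        |(T : ℝ) - C * m * ε / (n * √(d * Real.log (1 / δ)))| < 1 →
        -- closed convex feasible sets
        IsClosed Θ → Convex ℝ Θ → IsClosed Ω → Convex ℝ Ω → θ₀ ∈ Θ → ω₀ ∈ Ω →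
        DPTD.RegularLoss Θ Ω f Ξ →
        -- existence of a solution; `Δ` bounds the initial gap
        θopt ∈ Θ → IsMinOn (DPTD.primalValue (DPTD.objective f Ξ) Ω) Θ θopt →
        DPTD.primalValue (DPTD.objective f Ξ) Ω θ₀
          - DPTD.primalValue (DPTD.objective f Ξ) Ω θopt ≤ Δ →
        -- Lipschitz gradient, strong concavity
        DPTD.GradLipschitz Θ Ω (DPTD.objective f Ξ) LF →
        (∀ θ ∈ Θ, StrongConcaveOn Ω μ (DPTD.objective f Ξ θ)) →
        -- averaged `G`-Lipschitz along the `m` trajectories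
        (∀ i, DPTD.AveragedLipschitz Θ Ω f Ξ n G (len i)) →
        -- parameters of the algorithm, and its randomness
        I = { ν := fun t => 1 / (4 * √((t : ℝ) + b)), κ := κ, η := η, α := 3, β := 3,
              Θ := Θ, Ω := Ω, θ₀ := θ₀, ω₀ := ω₀ } →
        DPTD.Randomness P Ξ (DPTD.trajectoryVariance G β' ε δ n m T) T ξ up ud R →
        Integrable (fun w => DPTD.metric I (DPTD.objective f Ξ) LF
            (DPTD.run I f (fun t => ξ t w) (fun t => up t w) (fun t => ud t w) (R w))) P ∧
        ∫ w, DPTD.metric I (DPTD.objective f Ξ) LF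
            (DPTD.run I f (fun t => ξ t w) (fun t => up t w) (fun t => ud t w) (R w)) ∂P
          ≤ A * ((n : ℝ) ^ (1 / 4 : ℝ) * (d * Real.log (1 / δ)) ^ (1 / 8 : ℝ)
              / (m * ε) ^ (1 / 4 : ℝ)) * √(Real.log (T + b)) ∧
        (∀ w, (DPTD.run I f (fun t => ξ t w) (fun t => up t w) (fun t => ud t w) T).evals
          = 2 * (T + 1)) ∧
        2 * ((T : ℝ) + 1) ≤ A * (m * ε / (n * √(d * Real.log (1 / δ)))) := by
  have hb3 : 3 ≤ b := (le_max_right _ _).trans hb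
  set c₁ := 56 * C ^ 2 * G ^ 2 * (1 / (1 - β') + K) / β'
  set A₁ := √(48 * DPTD.momentConst LF μ G κ η Δ c₁ * √(1 + b) / κ * √(2 / C))
  -- `A₁` serves the rate, `6C` the gradient count: `2(T+1) ≤ 2Cr + 4 ≤ 6Cr` because `T < Cr + 1`
  -- and `Cr ≥ 1`.
  refine ⟨6 * C + A₁, by positivity, ?_⟩
  intro d n m T ε δ len 𝒳 _ Ξ _ f Θ Ω θ₀ ω₀ θopt W _ P _ ξ up ud R I hd hn hlen hε hδ hδ1 hεK hX1
    hTX hΘ hΘc hΩ hΩc hθ₀ hω₀ hf hθopt hmin hΔ' hlip hconc hG' hI hR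
  have hℓ : 0 < Real.log (1 / δ) := Real.log_pos (by rw [one_lt_div hδ]; exact hδ1)
  obtain ⟨i, hi⟩ := hlen.1
  have hm : 1 ≤ m := i.pos
  have hd0 : (0 : ℝ) < d := by exact_mod_cast hd
  have hn0 : (0 : ℝ) < n := by exact_mod_cast hn
  have hm0 : (0 : ℝ) < m := by exact_mod_cast hm
  set r := m * ε / (n * √(d * Real.log (1 / δ))) with hr
  have hr0 : 0 < r := by
    have : 0 < √(d * Real.log (1 / δ)) := Real.sqrt_pos.2 (by positivity)
    positivity
  have hCr : C * m * ε / (n * √(d * Real.log (1 / δ))) = C * r := by rw [hr]; ring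
  rw [hCr] at hX1 hTX
  obtain ⟨hT1, hT2⟩ := abs_lt.1 hTX
  -- Rounding moves `Cr ≥ 1` by strictly less than `1`, so `T` is positive even when rounded down.
  have hT : 1 ≤ T := by
    have : (0 : ℝ) < T := by linarith
    exact_mod_cast this
  have hT2' : (T : ℝ) ≤ 2 * (C * r) := by linarith
  -- The index `i` is a trajectory of maximal length `n`; for it the bound `nG` is exactly `G` per
  -- sample.
  have ho : DPTD.BoundedOracle Θ Ω f Ξ G := hf.boundedOracle hn (hi ▸ hG' i)
  have hsad : DPTD.SmoothSaddle Θ Ω (DPTD.objective f Ξ) LF μ :=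
    ⟨hΘ, hΘc, hΩ, hΩc, ⟨ω₀, hω₀⟩,
      fun θ hθ ω hω => (hf.hasFDerivAt_objective hθ hω).2.differentiableAt, hlip, hconc, hμ, hμLF⟩
  have hadm : DPTD.Admissible I LF μ := by
    subst hI
    refine ⟨rfl, rfl, hκ, hη, hη', hκ', fun t => ?_, DPTD.stepSize_le hb3, hθ₀, hω₀⟩
    have : 0 < √((t : ℝ) + b) :=
      Real.sqrt_pos.2 (by linarith [(Nat.cast_nonneg t : (0 : ℝ) ≤ t)])
    exact one_div_pos.2 (by linarith)
  subst hI
  obtain ⟨hint, hle⟩ := DPTD.integral_metric_le (c₁ := c₁) hsad ho hadm rfl hb3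
    (DPTD.trajectoryVariance_nonneg n m T hβ' hβ'' hε hℓ) hΔ (fun θ hθ => hmin hθ) hΔ' hR hT
    (DPTD.total_variance_le hβ' hβ'' hε hℓ hC hK hεK hd hn hm hT2') hC hr0 (by linarith)
  refine ⟨hint, hle.trans ?_, fun w => DPTD.run_evals _ _ _ _ _ _, ?_⟩
  · have hrate : √√(1 / r) = (n : ℝ) ^ (1 / 4 : ℝ) * (d * Real.log (1 / δ)) ^ (1 / 8 : ℝ)
        / (m * ε) ^ (1 / 4 : ℝ) := by
      rw [← DPTD.sqrt_sqrt_eq_rate hn0 (by positivity) (by positivity), hr, one_div_div]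
    rw [← hrate]
    gcongr
    exact le_add_of_nonneg_left (by positivity)
  · have : 0 ≤ A₁ * r := by positivity
    linarith
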